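/- Logarithms are to base 2 and $\log^{(j)}$ denotes the $j$ times iterated logarithm ($\log^{(0)}x=x$). There are $n$ balls and $n$ bins, and communication is synchronous. For $r\in\{1,2,\dots\}$ and a constant $\gamma>0$ let $\mathcal A_b(r)$ be the following algorithm. Let $l:=\lfloor \log^{(r)}n/\log^{(r+1)}n\rfloor$ and $$k(1):=1,\qquad k(2):=\min\{(\log^{(r-1)}n)^{\gamma},\sqrt{\log n}\},\qquad k(i+1):=\min\{k(i)e^{\lfloor k(i)\rfloor/5},\sqrt{\log n}\}\quad(i\ge 2).$$ In round $i$: (1) every ball that is not yet placed contacts $\lfloor k(i)\rfloor$ bins chosen independently and uniformly at random (with repetition), requesting permission to be placed; (2) every bin gives permission to exactly $\min\{l_i,s\}$ of the $s$ distinct balls that contacted it in this round, where $l_1:=l$ and $l_i:=1$ for $i\ge2$, and declines the other requests; (3) every ball with at least one permission picks one of the permitting bins, is placed into it, informs it, and terminates. Which of the requesting balls a bin permits, and which of the permitting bins a ball picks, is arbitrary: any deterministic rule is allowed, and it may depend on all requests sent so far, including those of the current round. (With $l_1=1$ and $k(2)=\min\{k(1)e^{\lfloor k(1)\rfloor/5},\sqrt{\log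 n}\}$ instead, this is the basic algorithm $\mathcal A_b$.) Messages are the requests, one answer (permission or refusal) to each request, and one notification from each ball to the bin it is placed into. Then $\gamma>0$ can be fixed, independently of $r$ and of everything else, such that the following holds. (A) For every $c>0$ there is a constant $C$, depending only on $c$, such that for every $r\ge1$, all sufficiently large $n$ (depending on $r$ and $c$) and every such rule, with probability at least $1-n^{-c}$ all of the following hold for $\mathcal A_b(r)$: * all balls are placed within $r+C$ rounds; * no bin ever contains more than $\log^{(r)}n/\log^{(r+1)}n+r+C$ balls; * in each round at most $n$ requests are sent, and at most $Cn$ messages are sent in total; * every ball sends and receives at most $C\sqrt{\log n}$ messages in total; * every bin sends and receives at most $C\log n/\log\log n$ messages in total. (B) There is an absolute constant $D$ such that for every $r\ge1$, all sufficiently large $n$ (depending on $r$) and every such rule, the expected number of messages that any given ball sends and receives during the whole execution of $\mathcal A_b(r)$ is at most $D$, and the same holds for any given bin. -/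

import Mathlib

open MeasureTheory

/-- The `r` times iterated binary logarithm `log^{(r)} x`. -/
noncomputable def iterLog (r : ℕ) (x : ℝ) : ℝ := (Real.logb 2)^[r] x

/-! ## The synchronous balls-into-bins process

Both the `n` balls and the `n` bins are labelled by `Fin n`. -/

/-- The requests sent in one round: ball `b` contacts the bins in the list `q b`. -/
abbrev Requests (n : ℕ) := Fin n → List (Fin n)

/-- The set of balls that contact bin `v` in a round with requests `q`. -/
def requesters {n : ℕ} (q : Requests n) (v : Fin n) : Finset (Fin n) :=
  Finset.univ.filter fun b => v ∈ q b

/-- A way to resolve the choices that the algorithm leaves open. They may depend on all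
requests that were sent so far, those of the current round included; the list `h` of these
tables has the current round at its head.

* A bin `v` that is asked by the set of balls `S` and may admit `cap` balls admits
  `grant h cap v S`: exactly `min cap |S|` balls out of `S`.
* A ball `b` that gets permission from the nonempty set of bins `S` goes into the bin
  `choose h b S`, a member of `S`. -/
structure ChoiceRule (n : ℕ) where
  grant : List (Requests n) → ℕ → Fin n → Finset (Fin n) → Finset (Fin n)
  grant_subset : ∀ h cap v S, grant h cap v S ⊆ S
  card_grant : ∀ h cap v S, (grant h cap v S).card = min cap S.card
  choose : List (Requests n) → Fin n → Finset (Fin n) → Fin n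
  choose_mem : ∀ h b S, S.Nonempty → choose h b S ∈ S

/-- A configuration between two rounds: `place b` is the bin in which ball `b` has been
placed (`none` while `b` is still active), and `history` lists the requests of all earlier
rounds, the latest round first. -/
structure Config (n : ℕ) where
  place : Fin n → Option (Fin n)
  history : List (Requests n)

/-- The bins to which ball `b` may go when the last round is the head of `h` and had the
requests `q`, and each bin admitted up to `cap` balls. -/
def permissions {n : ℕ} (rule : ChoiceRule n) (cap : ℕ) (h : List (Requests n))
    (q : Requests n) (b : Fin n) : Finset (Fin n) :=
  Finset.univ.filter fun v => b ∈ rule.grant h cap v (requesters q v)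

/-- The requests of a round in which every active ball contacts `m` bins, namely
`coins b 0, …, coins b (m - 1)`. -/
def roundRequests {n : ℕ} (m : ℕ) (coins : Fin n → ℕ → Fin n) (s : Config n) : Requests n :=
  fun b => if s.place b = none then (List.range m).map (coins b) else []

/-- One round: active balls contact `m` bins each, every bin gives permission to up to `cap`
of the balls that contacted it, and every ball that got a permission is placed. -/
def roundStep {n : ℕ} (rule : ChoiceRule n) (cap m : ℕ) (coins : Fin n → ℕ → Fin n)
    (s : Config n) : Config n :=
  let q := roundRequests m coins s
  let h := q :: s.history
  { place := fun b =>
      if s.place b = none then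
        if (permissions rule cap h q b).Nonempty then
          some (rule.choose h b (permissions rule cap h q b))
        else none
      else s.place b
    history := h }

/-- The parameters of an algorithm, where rounds are counted from `0`: the number `cap t` of
balls that a bin may admit in round `t`, and the number `req t` of bins that an active ball
contacts in round `t`. -/
structure Schedule where
  cap : ℕ → ℕ
  req : ℕ → ℕ

/-- The random choices: the `j`-th bin contacted by ball `b` in round `t` is `ω (t, b, j)`. -/
abbrev Coins (n : ℕ) := ℕ × Fin n × ℕ → Fin n

/-- All random choices are independent and uniform. -/
noncomputable def coinMeasure (n : ℕ) [NeZero n] : Measure (Coins n) :=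
  Measure.infinitePi fun _ => (PMF.uniformOfFintype (Fin n)).toMeasure

/-- The configuration after the first `t` rounds. -/
def run {n : ℕ} (A : Schedule) (rule : ChoiceRule n) (ω : Coins n) : ℕ → Config n
  | 0 => { place := fun _ => none, history := [] }
  | t + 1 => roundStep rule (A.cap t) (A.req t) (fun b j => ω (t, b, j)) (run A rule ω t)

/-- The requests sent in round `t`. -/
def requestsAt {n : ℕ} (A : Schedule) (rule : ChoiceRule n) (ω : Coins n) (t : ℕ) :
    Requests n :=
  roundRequests (A.req t) (fun b j => ω (t, b, j)) (run A rule ω t)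

/-- All balls have been placed after the first `t` rounds. -/
def TerminatedBy {n : ℕ} (A : Schedule) (rule : ChoiceRule n) (ω : Coins n) (t : ℕ) : Prop :=
  ∀ b, (run A rule ω t).place b ≠ none

/-- The number of balls in bin `v` after the first `t` rounds. -/
def load {n : ℕ} (A : Schedule) (rule : ChoiceRule n) (ω : Coins n) (t : ℕ) (v : Fin n) : ℕ :=
  (Finset.univ.filter fun b => (run A rule ω t).place b = some v).card

/-! ## Counting messages

Each request is one message; each request is answered by one message (permission or refusal);
each ball sends one message to the bin into which it is placed. -/

/-- The number of requests sent by all balls in round `t`. -/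
def totalRequests {n : ℕ} (A : Schedule) (rule : ChoiceRule n) (ω : Coins n) (t : ℕ) : ℕ :=
  ∑ b, (requestsAt A rule ω t b).length

/-- The number of requests that ball `b` sends in the first `t` rounds, which is also the
number of answers that it receives. -/
def ballRequests {n : ℕ} (A : Schedule) (rule : ChoiceRule n) (ω : Coins n) (t : ℕ)
    (b : Fin n) : ℕ :=
  ∑ j ∈ Finset.range t, (requestsAt A rule ω j b).length

/-- The number of requests that bin `v` receives in the first `t` rounds, which is also the
number of answers that it sends. -/
def binRequests {n : ℕ} (A : Schedule) (rule : ChoiceRule n) (ω : Coins n) (t : ℕ)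
    (v : Fin n) : ℕ :=
  ∑ j ∈ Finset.range t, ∑ b, (requestsAt A rule ω j b).count v

/-- Messages sent or received by ball `b` in the first `t` rounds: requests, answers, and the
notification of the chosen bin. -/
def ballMessages {n : ℕ} (A : Schedule) (rule : ChoiceRule n) (ω : Coins n) (t : ℕ)
    (b : Fin n) : ℕ :=
  ballRequests A rule ω t b + ballRequests A rule ω t b +
    if (run A rule ω t).place b = none then 0 else 1

/-- Messages sent or received by bin `v` in the first `t` rounds: requests, answers, and the
notifications of the balls placed into `v`. -/
def binMessages {n : ℕ} (A : Schedule) (rule : ChoiceRule n) (ω : Coins n) (t : ℕ)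
    (v : Fin n) : ℕ :=
  binRequests A rule ω t v + binRequests A rule ω t v + load A rule ω t v

/-- All messages of the first `t` rounds; each has exactly one ball as an endpoint. -/
def totalMessages {n : ℕ} (A : Schedule) (rule : ChoiceRule n) (ω : Coins n) (t : ℕ) : ℕ :=
  ∑ b, ballMessages A rule ω t b

/-! ## The algorithm `A_b(r)` -/

/-- The values `k(1), k(2), …` (here with indices `0, 1, …`): `k(1) = 1`,
`k(2) = min {(log^{(r-1)} n)^γ, √(log n)}`, and from then on
`k(i+1) = min {k(i) e^{⌊k(i)⌋/5}, √(log n)}`. -/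
noncomputable def kSeq (n r : ℕ) (γ : ℝ) : ℕ → ℝ
  | 0 => 1
  | 1 => min (iterLog (r - 1) n ^ γ) (Real.sqrt (Real.logb 2 n))
  | i + 2 => min (kSeq n r γ (i + 1) * Real.exp ((⌊kSeq n r γ (i + 1)⌋₊ : ℝ) / 5))
      (Real.sqrt (Real.logb 2 n))

/-- The algorithm `A_b(r)`: in its first round bins admit up to
`⌊log^{(r)} n / log^{(r+1)} n⌋` balls, in all later rounds they admit one ball. In its `i`-th
round each active ball contacts `⌊k(i)⌋` bins. -/
noncomputable def algAbr (n r : ℕ) (γ : ℝ) : Schedule where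
  cap t := if t = 0 then ⌊iterLog r n / iterLog (r + 1) n⌋₊ else 1
  req t := ⌊kSeq n r γ t⌋₊

/-! The choice rule is adversarial and sees the requests of the current round, so the failures of
different balls cannot be treated as independent. The way out is to fix a set `S` of balls
beforehand. If no ball of `S` is placed in a round, then every bin contacted from `S` gave its
permission to a ball outside `S`. Hence all requests of `S` hit bins that are also contacted from
outside `S`. With `a` active balls and `m` requests each, there are at most `a * m` such bins, and
they are determined by coins independent of those of `S`. So all of `S` fail with probability at
most `((a * m / n) ^ m) ^ |S|`, whatever the rule (`prob_subset_active_le`). A union bound over the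
sets of a given size then shows that the number of survivors is small, up to an exponentially small
error (`prob_card_gt_le`). In the first round, bins with at least `l` contacts from outside `S` take
over this role; a fraction of order `(e / l) ^ l ≤ (log^{(r-1)} n)^(-1/2)` of all bins is of this
kind.

The analysis carries the invariant `FewRequests`: (active balls) · `k` ≤ `η n` with `η ≤ 1/8`. The
first round establishes it because `γ = 1/4` lies below the exponent 1/2. It persists because a
round with `m` requests per ball leaves a fraction of order `η ^ m`, which outweighs the growth `e ^
(m / 5)` of `k` (`two_exp_mul_pow_le_one`). The growth of `k` undoes one logarithm per round, so `k`
is at its cap `√(log n)` from index `r` on (`kSeq_eq_sqrt`). One such round leaves at most `n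
2^(-⌊√(log n)⌋)` balls, and each later round is survived with probability at most `n^(-1/4)`
(`survival_le`), so a constant number of further rounds suffices. Conversely `k` stays below the
iterated logarithms (`kSeq_le_iterLog`), so only boundedly many rounds cost a ball `√(log n)`
requests.

The requests received by a bin are controlled by a moment generating function, multiplied up round
by round (`lintegral_pow_binRequests_le`). For the expectations, `k` times the survival probability
of a ball halves in each round (`mul_prob_mem_active_le`), so the expected costs form a geometric
series. The exceptional event is so unlikely that a crude polynomial bound is enough there. -/

theorem dependsOn_comp {ι α β γ : Type*} {f : (ι → γ) → α} {s : Set ι}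
    (h : DependsOn f s) (g : α → β) : DependsOn (fun ω => g (f ω)) s :=
  fun _ _ hxy => congrArg g (h hxy)

/-! ### Independent uniform coins -/

section CoinMeasure

open ProbabilityTheory ENNReal

variable {n : ℕ} [NeZero n]

instance : IsProbabilityMeasure (coinMeasure n) := by
  unfold coinMeasure; infer_instance

theorem measurable_of_dependsOn {β : Type*} [MeasurableSpace β] {f : Coins n → β}
    {S : Finset (ℕ × Fin n × ℕ)} (hf : DependsOn f (S : Set (ℕ × Fin n × ℕ))) :
    Measurable f := by
  have : Nonempty β := ⟨f fun _ => 0⟩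
  obtain ⟨g, rfl⟩ := dependsOn_iff_exists_comp.1 hf
  exact (Measurable.of_discrete (f := g)).comp (measurable_pi_lambda _ fun i => measurable_pi_apply _)

/-- Coins from disjoint finite sets of positions are independent, so one of the two groups may be
drawn afresh. -/
theorem lintegral_resample {S T : Finset (ℕ × Fin n × ℕ)} (hST : Disjoint S T)
    {F : Coins n → Coins n → ℝ≥0∞}
    (hS : ∀ y, DependsOn (fun x => F x y) (S : Set (ℕ × Fin n × ℕ)))
    (hT : ∀ x, DependsOn (F x) (T : Set (ℕ × Fin n × ℕ))) :
    ∫⁻ ω, F ω ω ∂coinMeasure n = ∫⁻ y, ∫⁻ x, F x y ∂coinMeasure n ∂coinMeasure n := by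
  classical
  -- Through `e` and `ρ` the integrand factors over a finite discrete space, which makes it
  -- measurable without further assumptions.
  let e : ∀ U : Finset (ℕ × Fin n × ℕ), (U → Fin n) → Coins n :=
    fun U u p => if h : p ∈ U then u ⟨p, h⟩ else 0
  let ρ : ∀ U : Finset (ℕ × Fin n × ℕ), Coins n → (U → Fin n) := fun U ω p => ω p
  have hρ : ∀ U, Measurable (ρ U) := fun U => measurable_pi_lambda _ fun i => measurable_pi_apply _
  let G : (S → Fin n) × (T → Fin n) → ℝ≥0∞ := fun u => F (e S u.1) (e T u.2)
  have hG : Measurable G := Measurable.of_discrete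
  have hF : ∀ x y, F x y = G (ρ S x, ρ T y) := by
    intro x y
    have h1 : F x y = F (e S (ρ S x)) y := hS y fun i hi => by
      have hi' : i ∈ S := hi
      simp [e, ρ, hi']
    have h2 : F (e S (ρ S x)) y = F (e S (ρ S x)) (e T (ρ T y)) := hT _ fun i hi => by
      have hi' : i ∈ T := hi
      simp [e, ρ, hi']
    exact h1.trans h2
  have hind : IndepFun (ρ S) (ρ T) (coinMeasure n) :=
    iIndepFun.indepFun_finset (f := fun (p : ℕ × Fin n × ℕ) (ω : Coins n) => ω p) S T hST
      (iIndepFun_infinitePi (X := fun _ x => x) fun _ => measurable_id)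
      fun p => measurable_pi_apply p
  simp_rw [hF]
  rw [← lintegral_map (f := G) hG ((hρ S).prodMk (hρ T)),
    hind.map_prod_eq_prod_map_map (hρ S).aemeasurable (hρ T).aemeasurable]
  have : IsProbabilityMeasure ((coinMeasure n).map (ρ S)) :=
    Measure.isProbabilityMeasure_map (hρ S).aemeasurable
  have : IsProbabilityMeasure ((coinMeasure n).map (ρ T)) :=
    Measure.isProbabilityMeasure_map (hρ T).aemeasurable
  rw [lintegral_prod_symm _ hG.aemeasurable,
    lintegral_map (hG.lintegral_prod_left') (hρ T)]
  refine lintegral_congr fun y => ?_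
  rw [lintegral_map (f := fun u => G (u, ρ T y)) Measurable.of_discrete (hρ S)]

theorem coinMeasure_forall_mem (I : Finset (ℕ × Fin n × ℕ)) (V : Finset (Fin n)) :
    coinMeasure n {ω | ∀ p ∈ I, ω p ∈ V} = ((V.card : ℝ≥0∞) / n) ^ I.card := by
  have : {ω : Coins n | ∀ p ∈ I, ω p ∈ V} = Set.pi (I : Set (ℕ × Fin n × ℕ)) fun _ => V := by
    ext; simp
  rw [this, coinMeasure, Measure.infinitePi_pi _ (fun _ _ => MeasurableSet.of_discrete),
    Finset.prod_const, PMF.toMeasure_uniformOfFintype_apply _ MeasurableSet.of_discrete]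
  simp

theorem lintegral_indicator_coin_eq (p : ℕ × Fin n × ℕ) (v : Fin n) (y : ℝ≥0∞) :
    ∫⁻ ω, (if ω p = v then y else 0) ∂coinMeasure n = y / n := by
  have h := coinMeasure_forall_mem {p} {v}
  have hm : MeasurableSet {ω : Coins n | ω p = v} :=
    measurableSet_eq_fun (measurable_pi_apply p) measurable_const
  have : (fun ω : Coins n => if ω p = v then y else 0)
      = Set.indicator {ω : Coins n | ω p = v} fun _ => y := by
    ext ω; simp [Set.indicator]
  rw [this, lintegral_indicator_const hm]
  simp at h
  rw [h, div_eq_mul_inv]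

/-- Coins that have to fall into a small random set determined by other coins. -/
theorem coinMeasure_forall_mem_le {I J : Finset (ℕ × Fin n × ℕ)} (hIJ : Disjoint I J)
    {V : Coins n → Finset (Fin n)} (hV : DependsOn V (J : Set (ℕ × Fin n × ℕ))) {w : ℝ≥0∞}
    (hw : ∀ ω, ((V ω).card : ℝ≥0∞) ≤ w) :
    coinMeasure n {ω | ∀ p ∈ I, ω p ∈ V ω} ≤ (w / n) ^ I.card := by
  classical
  -- The argument `x` carries the coins of `I` and `y` those that determine `V`. After resampling,
  -- `V y` is a fixed set.
  let F : Coins n → Coins n → ℝ≥0∞ := fun x y => if ∀ p ∈ I, x p ∈ V y then 1 else 0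
  have hS : ∀ y, DependsOn (fun x => F x y) (I : Set (ℕ × Fin n × ℕ)) := by
    intro y a b hab
    have : (∀ p ∈ I, a p ∈ V y) ↔ (∀ p ∈ I, b p ∈ V y) :=
      forall₂_congr fun p hp => by rw [hab p hp]
    simp only [F, this]
  have hT : ∀ x, DependsOn (F x) (J : Set (ℕ × Fin n × ℕ)) := fun x =>
    dependsOn_comp hV fun W => if ∀ p ∈ I, x p ∈ W then (1 : ℝ≥0∞) else 0
  have hm : MeasurableSet {ω : Coins n | ∀ p ∈ I, ω p ∈ V ω} := by
    have : Measurable fun ω : Coins n => (∀ p ∈ I, ω p ∈ V ω) :=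
      measurable_of_dependsOn (S := I ∪ J) fun a b hab => by
        have h1 : V a = V b := hV fun i hi => hab i (by simp at hi ⊢; exact Or.inr hi)
        rw [h1]
        exact propext (forall₂_congr fun p hp => by rw [hab p (by simp [hp])])
    exact this.setOf
  have h0 : coinMeasure n {ω : Coins n | ∀ p ∈ I, ω p ∈ V ω} = ∫⁻ ω, F ω ω ∂coinMeasure n := by
    rw [← lintegral_indicator_one hm]
    refine lintegral_congr fun ω => ?_
    simp [F, Set.indicator]
  rw [h0, lintegral_resample hIJ hS hT]
  refine (lintegral_mono (g := fun _ => (w / n) ^ I.card) fun y => ?_).trans (by simp)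
  have hm' : MeasurableSet {ω : Coins n | ∀ p ∈ I, ω p ∈ V y} := by
    have : Measurable fun ω : Coins n => (∀ p ∈ I, ω p ∈ V y) :=
      measurable_of_dependsOn (S := I) fun a b hab =>
        propext (forall₂_congr fun p hp => by rw [hab p (by simpa using hp)])
    exact this.setOf
  have h1 : ∫⁻ x, F x y ∂coinMeasure n = coinMeasure n {ω : Coins n | ∀ p ∈ I, ω p ∈ V y} := by
    rw [← lintegral_indicator_one hm']
    refine lintegral_congr fun ω => ?_
    simp [F, Set.indicator]
  rw [h1, coinMeasure_forall_mem]
  exact pow_le_pow_left' (ENNReal.div_le_div_right (hw y) _) _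

/-- The moment generating function of the number of coins in `I` that show `v`. -/
theorem lintegral_pow_card_coins (I : Finset (ℕ × Fin n × ℕ)) (v : Fin n) (y : ℝ≥0∞) :
    ∫⁻ ω, (1 + y) ^ (I.filter fun p => ω p = v).card ∂coinMeasure n = (1 + y / n) ^ I.card := by
  classical
  induction I using Finset.induction_on with
  | empty => simp
  | insert p I hp ih =>
    let F : Coins n → Coins n → ℝ≥0∞ := fun x z =>
      (1 + if x p = v then y else 0) * (1 + y) ^ (I.filter fun p => z p = v).card
    have h1 : ∀ ω : Coins n,
        (1 + y) ^ ((insert p I).filter fun p => ω p = v).card = F ω ω := by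
      intro ω
      by_cases h : ω p = v
      · simp [F, Finset.filter_insert, h, hp, pow_succ, mul_comm]
      · simp [F, Finset.filter_insert, h]
    simp_rw [h1]
    have hS : ∀ z, DependsOn (fun x => F x z) (({p} : Finset (ℕ × Fin n × ℕ)) : Set (ℕ × Fin n × ℕ)) :=
      fun z a b hab => by simp [F, hab p (by simp)]
    have hdep : DependsOn (fun z : Coins n => (1 + y) ^ (I.filter fun p => z p = v).card)
        (I : Set (ℕ × Fin n × ℕ)) := fun a b hab => by
      have : I.filter (fun p => a p = v) = I.filter (fun p => b p = v) :=
        Finset.filter_congr fun q hq => by rw [hab q hq]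
      simp [this]
    have hT : ∀ x, DependsOn (F x) (I : Set (ℕ × Fin n × ℕ)) := fun x =>
      dependsOn_comp hdep fun t => (1 + if x p = v then y else 0) * t
    rw [lintegral_resample (S := {p}) (T := I) (by simpa using hp) hS hT]
    have h2 : ∀ z : Coins n, ∫⁻ x, F x z ∂coinMeasure n
        = (1 + y / n) * (1 + y) ^ (I.filter fun p => z p = v).card := by
      intro z
      have hm : Measurable fun x : Coins n => 1 + if x p = v then y else 0 :=
        measurable_of_dependsOn (S := {p}) fun a b hab => by simp [hab p (by simp)]
      have h3 : ∫⁻ x : Coins n, (1 + if x p = v then y else 0) ∂coinMeasure n = 1 + y / n := by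
        rw [lintegral_add_left measurable_const, lintegral_indicator_coin_eq]
        simp
      rw [← h3, ← lintegral_mul_const _ hm]
    simp_rw [h2]
    rw [lintegral_const_mul _ (measurable_of_dependsOn hdep), ih, Finset.card_insert_of_notMem hp,
      pow_succ, mul_comm]

theorem lintegral_card_coins (I : Finset (ℕ × Fin n × ℕ)) (v : Fin n) :
    ∫⁻ ω, ((I.filter fun p => ω p = v).card : ℝ≥0∞) ∂coinMeasure n = I.card / n := by
  classical
  have h1 : ∀ ω : Coins n, ((I.filter fun p => ω p = v).card : ℝ≥0∞)
      = ∑ p ∈ I, if ω p = v then 1 else 0 := by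
    intro ω; simp
  simp_rw [h1]
  rw [lintegral_finsetSum I fun p _ => measurable_of_dependsOn (S := {p}) fun a b hab => by
    simp [hab p (by simp)]]
  simp_rw [lintegral_indicator_coin_eq]
  simp [div_eq_mul_inv]

theorem coinMeasure_real_forall_mem_le {I J : Finset (ℕ × Fin n × ℕ)} (hIJ : Disjoint I J)
    {V : Coins n → Finset (Fin n)} (hV : DependsOn V (J : Set (ℕ × Fin n × ℕ))) {w : ℝ}
    (hw : ∀ ω, ((V ω).card : ℝ) ≤ w) :
    (coinMeasure n).real {ω | ∀ p ∈ I, ω p ∈ V ω} ≤ (w / n) ^ I.card := by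
  have hw0 : 0 ≤ w := (Nat.cast_nonneg _).trans (hw fun _ => 0)
  have hn : (0 : ℝ) < n := Nat.cast_pos.2 (NeZero.pos n)
  have h := coinMeasure_forall_mem_le hIJ hV (w := ENNReal.ofReal w) fun ω => by
    rw [← ENNReal.ofReal_natCast]; exact ENNReal.ofReal_le_ofReal (hw ω)
  refine ENNReal.toReal_le_of_le_ofReal (by positivity) (h.trans_eq ?_)
  rw [ENNReal.ofReal_pow (by positivity), ENNReal.ofReal_div_of_pos hn, ENNReal.ofReal_natCast]

end CoinMeasure

/-! ### Survival in a single round, uniformly over the choice rule -/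

section OneRound

variable {n : ℕ}

/-- The balls that have not been placed. -/
def activeBalls (s : Config n) : Finset (Fin n) :=
  Finset.univ.filter fun b => s.place b = none

/-- The outcome of a round, given its requests. -/
def nextConfig (rule : ChoiceRule n) (cap : ℕ) (s : Config n) (q : Requests n) : Config n where
  place := fun b =>
    if s.place b = none then
      if (permissions rule cap (q :: s.history) q b).Nonempty then
        some (rule.choose (q :: s.history) b (permissions rule cap (q :: s.history) q b))
      else none
    else s.place b
  history := q :: s.history

theorem roundStep_eq (rule : ChoiceRule n) (cap m : ℕ) (coins : Fin n → ℕ → Fin n)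
    (s : Config n) :
    roundStep rule cap m coins s = nextConfig rule cap s (roundRequests m coins s) := rfl

theorem nextConfig_place_eq_none {rule : ChoiceRule n} {cap : ℕ} {s : Config n} {q : Requests n}
    {b : Fin n} : (nextConfig rule cap s q).place b = none ↔
      s.place b = none ∧ permissions rule cap (q :: s.history) q b = ∅ := by
  by_cases h : s.place b = none
  · by_cases h' : (permissions rule cap (q :: s.history) q b).Nonempty
    · simp [nextConfig, h, h', h'.ne_empty]
    · simp [nextConfig, h, Finset.not_nonempty_iff_eq_empty.1 h']
  · simp [nextConfig, h]

theorem activeBalls_nextConfig_subset (rule : ChoiceRule n) (cap : ℕ) (s : Config n)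
    (q : Requests n) : activeBalls (nextConfig rule cap s q) ⊆ activeBalls s := by
  intro b hb
  simp only [activeBalls, Finset.mem_filter, Finset.mem_univ, true_and,
    nextConfig_place_eq_none] at hb ⊢
  exact hb.1

theorem mem_requesters_roundRequests {m : ℕ} {coins : Fin n → ℕ → Fin n} {s : Config n}
    {b v : Fin n} : b ∈ requesters (roundRequests m coins s) v ↔
      b ∈ activeBalls s ∧ ∃ j < m, coins b j = v := by
  by_cases h : s.place b = none <;>
    simp [requesters, roundRequests, activeBalls, h]

/-- If no ball of `S` is placed, then the balls that are granted a place in any bin are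
outside of `S`. -/
theorem notMem_of_mem_grant {rule : ChoiceRule n} {cap m : ℕ} {coins : Fin n → ℕ → Fin n}
    {s : Config n} {S : Finset (Fin n)}
    (hS : S ⊆ activeBalls (roundStep rule cap m coins s)) {v b : Fin n}
    (hb : b ∈ rule.grant (roundRequests m coins s :: s.history) cap v
      (requesters (roundRequests m coins s) v)) : b ∉ S := by
  intro hbS
  have h := hS hbS
  rw [activeBalls, Finset.mem_filter, roundStep_eq, nextConfig_place_eq_none] at h
  have hv : v ∈ permissions rule cap (roundRequests m coins s :: s.history)
      (roundRequests m coins s) b := by simp [permissions, hb]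
  simp [h.2.2] at hv

/-- The bins contacted by the active balls outside of `S`. -/
def contactedOutside (m : ℕ) (coins : Fin n → ℕ → Fin n) (s : Config n) (S : Finset (Fin n)) :
    Finset (Fin n) :=
  (activeBalls s \ S).biUnion fun b => (Finset.range m).image (coins b)

theorem card_contactedOutside_le (m : ℕ) (coins : Fin n → ℕ → Fin n) (s : Config n)
    (S : Finset (Fin n)) :
    (contactedOutside m coins s S).card ≤ (activeBalls s).card * m := by
  refine (Finset.card_biUnion_le_card_mul _ _ m fun b _ => ?_).trans
    (Nat.mul_le_mul_right _ (Finset.card_le_card Finset.sdiff_subset))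
  exact Finset.card_image_le.trans (Finset.card_range m).le

/-- A bin contacted by `b` admits some ball because `cap ≥ 1`. Every ball of `S` fails, so the
admitted ball lies outside `S` and has contacted the same bin. The conclusion no longer mentions the
choice rule. -/
theorem mem_contactedOutside_of_fail {rule : ChoiceRule n} {cap m : ℕ} (hcap : 1 ≤ cap)
    {coins : Fin n → ℕ → Fin n} {s : Config n} {S : Finset (Fin n)}
    (hS : S ⊆ activeBalls (roundStep rule cap m coins s)) {b : Fin n} (hb : b ∈ S) {j : ℕ}
    (hj : j < m) : coins b j ∈ contactedOutside m coins s S := by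
  have hbs : b ∈ activeBalls s := activeBalls_nextConfig_subset _ _ _ _ (hS hb)
  have hreq : b ∈ requesters (roundRequests m coins s) (coins b j) :=
    mem_requesters_roundRequests.2 ⟨hbs, j, hj, rfl⟩
  have hcard := rule.card_grant (roundRequests m coins s :: s.history) cap (coins b j)
    (requesters (roundRequests m coins s) (coins b j))
  have hpos : 0 < (requesters (roundRequests m coins s) (coins b j)).card :=
    Finset.card_pos.2 ⟨b, hreq⟩
  obtain ⟨b', hb'⟩ := Finset.card_pos.1 (hcard ▸ lt_min (by omega) hpos :
    0 < (rule.grant (roundRequests m coins s :: s.history) cap (coins b j)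
      (requesters (roundRequests m coins s) (coins b j))).card)
  have hb'S := notMem_of_mem_grant hS hb'
  obtain ⟨ha, i, hi, hij⟩ := mem_requesters_roundRequests.1 (rule.grant_subset _ _ _ _ hb')
  simp only [contactedOutside, Finset.mem_biUnion, Finset.mem_sdiff, Finset.mem_image,
    Finset.mem_range]
  exact ⟨b', ⟨ha, hb'S⟩, i, hi, hij⟩

/-- The outcome of a round depends on its coins only. -/
theorem dependsOn_roundCoins {α : Type*} (t m : ℕ) (B : Finset (Fin n))
    (f : (Fin n → ℕ → Fin n) → α)
    (hf : ∀ c c', (∀ b ∈ B, ∀ j < m, c b j = c' b j) → f c = f c') :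
    DependsOn (fun x : Coins n => f fun b j => x (t, b, j))
      (({t} ×ˢ B ×ˢ Finset.range m : Finset (ℕ × Fin n × ℕ)) : Set (ℕ × Fin n × ℕ)) := by
  intro x y hxy
  refine hf _ _ fun b hb j hj => hxy _ ?_
  simp [hb, hj]

theorem contactedOutside_congr {m : ℕ} {c c' : Fin n → ℕ → Fin n} {s : Config n}
    {S : Finset (Fin n)} (h : ∀ b ∈ activeBalls s \ S, ∀ j < m, c b j = c' b j) :
    contactedOutside m c s S = contactedOutside m c' s S := by
  refine Finset.biUnion_congr rfl fun b hb => Finset.image_congr fun j hj => h b hb j ?_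
  simpa using hj

theorem roundRequests_congr {m : ℕ} {c c' : Fin n → ℕ → Fin n} {s : Config n}
    (h : ∀ b ∈ activeBalls s, ∀ j < m, c b j = c' b j) :
    roundRequests m c s = roundRequests m c' s := by
  funext b
  by_cases hb : s.place b = none
  · simp only [roundRequests, hb, if_true]
    exact List.map_congr_left fun j hj => h b (by simp [activeBalls, hb]) j (by simpa using hj)
  · simp [roundRequests, hb]

/-- The bins that are contacted by at least `l` balls outside of `S`, when each ball contacts
one bin. -/
def heavyBins (l : ℕ) (S : Finset (Fin n)) (c : Fin n → Fin n) : Finset (Fin n) :=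
  Finset.univ.filter fun v => l ≤ (Sᶜ.filter fun b => c b = v).card

theorem heavyBins_subset (l : ℕ) (S : Finset (Fin n)) (c : Fin n → Fin n) :
    heavyBins l S c ⊆ heavyBins l ∅ c := by
  intro v hv
  simp only [heavyBins, Finset.mem_filter, Finset.mem_univ, true_and] at hv ⊢
  exact hv.trans (Finset.card_le_card (Finset.filter_subset_filter _ (by simp)))

/-- A bin that admits fewer than `l` balls admits all its requesters, in particular `b`. Hence the
bin contacted by `b` admits `l` balls, none of which belongs to `S`. -/
theorem mem_heavyBins_of_fail {rule : ChoiceRule n} {l : ℕ} {c : Fin n → ℕ → Fin n}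
    {s : Config n} {S : Finset (Fin n)}
    (hS : S ⊆ activeBalls (roundStep rule l 1 c s)) {b : Fin n} (hb : b ∈ S) :
    c b 0 ∈ heavyBins l S fun b => c b 0 := by
  have hbs : b ∈ activeBalls s := activeBalls_nextConfig_subset _ _ _ _ (hS hb)
  set v := c b 0
  set q := roundRequests 1 c s
  have hreq : b ∈ requesters q v :=
    mem_requesters_roundRequests.2 ⟨hbs, 0, one_pos, rfl⟩
  have hcard := rule.card_grant (q :: s.history) l v (requesters q v)
  have hlt : l ≤ (rule.grant (q :: s.history) l v (requesters q v)).card := by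
    rw [hcard]
    refine le_min le_rfl ?_
    by_contra hcon
    rw [min_eq_right (not_le.1 hcon).le] at hcard
    have := Finset.eq_of_subset_of_card_le (rule.grant_subset (q :: s.history) l v _) hcard.ge
    exact notMem_of_mem_grant hS (this.symm ▸ hreq : b ∈ rule.grant _ _ _ _) hb
  simp only [heavyBins, Finset.mem_filter, Finset.mem_univ, true_and]
  refine hlt.trans (Finset.card_le_card fun b' hb' => ?_)
  obtain ⟨-, j, hj, hjv⟩ := mem_requesters_roundRequests.1 (rule.grant_subset _ _ _ _ hb')
  obtain rfl : j = 0 := by omega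
  simp [notMem_of_mem_grant hS hb', hjv]

/-- Repeated requests to one bin count with multiplicity, so the total is a plain count of coins, to
which the moment computations for coins apply. -/
theorem sum_count_roundRequests (m t : ℕ) (x : Coins n) (s : Config n) (v : Fin n) :
    ∑ b, (roundRequests m (fun b j => x (t, b, j)) s b).count v =
      (({t} ×ˢ activeBalls s ×ˢ Finset.range m : Finset (ℕ × Fin n × ℕ)).filter
        fun p => x p = v).card := by
  rw [Finset.card_filter, Finset.sum_product, Finset.sum_singleton, Finset.sum_product,
    activeBalls, Finset.sum_filter]
  refine Finset.sum_congr rfl fun b _ => ?_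
  by_cases h : s.place b = none
  · simp only [roundRequests, h, if_true]
    rw [← Finset.card_filter, List.count, List.countP_map, List.countP_eq_length_filter]
    rw [← List.toFinset_card_of_nodup (List.nodup_range.filter _)]
    congr 1
    ext j
    simp
  · simp [roundRequests, h]

variable [NeZero n]

/-- The probability that all balls of a set `S` fail in one round. -/
theorem prob_subset_active_le (rule : ChoiceRule n) {cap : ℕ} (hcap : 1 ≤ cap) (m t : ℕ)
    (s : Config n) (S : Finset (Fin n)) :
    (coinMeasure n).real
      {x : Coins n | S ⊆ activeBalls (roundStep rule cap m (fun b j => x (t, b, j)) s)} ≤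
      ((((activeBalls s).card * m : ℝ) / n) ^ m) ^ S.card := by
  have hd : Disjoint ({t} ×ˢ S ×ˢ Finset.range m : Finset (ℕ × Fin n × ℕ))
      ({t} ×ˢ (activeBalls s \ S) ×ˢ Finset.range m) := by
    rw [Finset.disjoint_left]
    simp only [Finset.mem_product, Finset.mem_sdiff]
    tauto
  have h := coinMeasure_real_forall_mem_le hd
    (V := fun x => contactedOutside m (fun b j => x (t, b, j)) s S)
    (dependsOn_roundCoins t m _ (fun c => contactedOutside m c s S)
      fun c c' hc => contactedOutside_congr hc)
    (w := (activeBalls s).card * m)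
    fun ω => by exact_mod_cast card_contactedOutside_le m _ s S
  rw [← pow_mul]
  refine (measureReal_mono fun x hx p hp => ?_).trans (h.trans_eq ?_)
  · obtain ⟨t', b, j⟩ := p
    simp only [Finset.mem_product, Finset.mem_singleton, Finset.mem_range] at hp
    obtain ⟨rfl, hb, hj⟩ := hp
    exact mem_contactedOutside_of_fail hcap hx hb hj
  · simp [mul_comm]

/-- `k ^ k / k!` is a single term of the exponential series of `e ^ k`. -/
theorem pow_le_factorial_mul_exp (k : ℕ) : (k : ℝ) ^ k ≤ k.factorial * Real.exp 1 ^ k := by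
  have h := Real.pow_div_factorial_le_exp (x := k) (Nat.cast_nonneg k) k
  rw [div_le_iff₀ (by positivity)] at h
  rwa [← Real.exp_nat_mul, mul_one, mul_comm]

/-- A random set all of whose subsets are unlikely to occur is small. -/
theorem prob_card_gt_le {U : Coins n → Finset (Fin n)} {A : Finset (Fin n)}
    (hUA : ∀ ω, U ω ⊆ A) {p θ : ℝ} (hp : 0 ≤ p) (hθ : 0 ≤ θ)
    (hU : ∀ S ⊆ A, (coinMeasure n).real {ω | S ⊆ U ω} ≤ p ^ S.card)
    (h : 2 * Real.exp 1 * A.card * p ≤ θ) :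
    (coinMeasure n).real {ω | θ < (U ω).card} ≤ (1 / 2 : ℝ) ^ θ := by
  -- More than `θ` elements means at least `s`. The union bound over `s`-subsets gives `C(|A|, s) p
  -- ^ s ≤ (e |A| p / s) ^ s`, and this is at most `2 ^ (-s)` since `2 e |A| p ≤ θ ≤ s`.
  set s : ℕ := ⌊θ⌋₊ + 1 with hs
  have hs0 : (0 : ℝ) < s := by positivity
  have hθs : θ ≤ s := by rw [hs]; push_cast; exact (Nat.lt_floor_add_one θ).le
  have h1 : (coinMeasure n).real {ω | θ < (U ω).card} ≤
      ∑ S ∈ A.powersetCard s, (coinMeasure n).real {ω | S ⊆ U ω} := by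
    refine (measureReal_mono (fun ω hω => ?_) (measure_ne_top _ _)).trans
      (measureReal_biUnion_finset_le (A.powersetCard s) fun S => {ω | S ⊆ U ω})
    have : s ≤ (U ω).card := by
      have := (Nat.floor_lt hθ).2 hω
      omega
    obtain ⟨S, hSU, hSc⟩ := Finset.exists_subset_card_eq this
    simp only [Set.mem_iUnion]
    exact ⟨S, Finset.mem_powersetCard.2 ⟨hSU.trans (hUA ω), hSc⟩, hSU⟩
  have h2 : ∑ S ∈ A.powersetCard s, (coinMeasure n).real {ω | S ⊆ U ω} ≤
      (A.card.choose s : ℝ) * p ^ s := by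
    refine (Finset.sum_le_card_nsmul _ _ (p ^ s) fun S hS => ?_).trans_eq ?_
    · rw [Finset.mem_powersetCard] at hS
      rw [← hS.2]; exact hU S hS.1
    · simp
  have h3 : (A.card.choose s : ℝ) ≤ A.card ^ s / s.factorial := Nat.choose_le_pow_div s A.card
  have h4 : (A.card : ℝ) ^ s / s.factorial * p ^ s ≤ (1 / 2) ^ s := by
    have h5 := pow_le_factorial_mul_exp s
    have h6 : (2 * Real.exp 1 * A.card * p) ^ s ≤ (s : ℝ) ^ s := by
      gcongr; exact h.trans hθs
    have h7 := h6.trans h5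
    rw [mul_pow, mul_pow, mul_pow] at h7
    have he : 0 < Real.exp 1 ^ s := by positivity
    have h8 : (2 : ℝ) ^ s * (A.card : ℝ) ^ s * p ^ s ≤ s.factorial := by
      refine le_of_mul_le_mul_right ?_ he
      linarith
    rw [div_pow, one_pow, div_mul_eq_mul_div, div_le_div_iff₀ (by positivity) (by positivity)]
    linarith
  calc _ ≤ (A.card.choose s : ℝ) * p ^ s := h1.trans h2
    _ ≤ (A.card : ℝ) ^ s / s.factorial * p ^ s := by gcongr
    _ ≤ (1 / 2) ^ s := h4
    _ = (1 / 2 : ℝ) ^ (s : ℝ) := (Real.rpow_natCast _ _).symm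
    _ ≤ (1 / 2 : ℝ) ^ θ :=
      Real.rpow_le_rpow_of_exponent_ge (by norm_num) (by norm_num) hθs

/-- After one round few balls are left. -/
theorem prob_card_active_gt_le (rule : ChoiceRule n) {cap : ℕ} (hcap : 1 ≤ cap) (m t : ℕ)
    (s : Config n) {θ : ℝ} (hθ : 0 ≤ θ)
    (h : 2 * Real.exp 1 * (activeBalls s).card *
      (((activeBalls s).card * m : ℝ) / n) ^ m ≤ θ) :
    (coinMeasure n).real
      {x : Coins n | θ < (activeBalls (roundStep rule cap m (fun b j => x (t, b, j)) s)).card} ≤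
      (1 / 2 : ℝ) ^ θ :=
  prob_card_gt_le (fun _ => activeBalls_nextConfig_subset _ _ _ _) (by positivity) hθ
    (fun S _ => prob_subset_active_le rule hcap m t s S) h

/-! ### The first round -/

/-- If all bins of `V` are heavy, some `k = |V| l` balls all land in `V`. The union bound over these
sets of balls gives `C(n, k) (|V| / n) ^ k ≤ (e |V| / k) ^ k = (e / l) ^ k`. -/
theorem prob_subset_heavyBins_le {l : ℕ} (hl : 1 ≤ l) (V : Finset (Fin n)) :
    (coinMeasure n).real {x : Coins n | V ⊆ heavyBins l ∅ fun b => x (0, b, 0)} ≤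
      ((Real.exp 1 / l) ^ l) ^ V.card := by
  set k := V.card * l with hk
  have hn : (0 : ℝ) < n := Nat.cast_pos.2 (NeZero.pos n)
  have h1 : (coinMeasure n).real {x : Coins n | V ⊆ heavyBins l ∅ fun b => x (0, b, 0)} ≤
      ∑ B ∈ (Finset.univ : Finset (Fin n)).powersetCard k,
        (coinMeasure n).real {x : Coins n | ∀ p ∈ ({0} ×ˢ B ×ˢ {0} : Finset (ℕ × Fin n × ℕ)),
          x p ∈ V} := by
    refine (measureReal_mono (fun x hx => ?_) (measure_ne_top _ _)).trans
      (measureReal_biUnion_finset_le _ _)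
    have hcard : k ≤ (Finset.univ.filter fun b => x (0, b, 0) ∈ V).card := by
      rw [Finset.card_eq_sum_card_fiberwise (f := fun b => x (0, b, 0)) (t := V)
        (fun b hb => by simpa using hb), hk, ← smul_eq_mul]
      refine Finset.card_nsmul_le_sum _ _ _ fun v hv => ?_
      have := hx hv
      simp only [heavyBins, Finset.mem_filter, Finset.mem_univ, true_and, Finset.compl_empty]
        at this
      refine this.trans (Finset.card_le_card fun b hb => ?_)
      simp only [Finset.mem_filter, Finset.mem_univ, true_and] at hb ⊢
      exact ⟨hb ▸ hv, hb⟩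
    obtain ⟨B, hB, hBc⟩ := Finset.exists_subset_card_eq hcard
    simp only [Set.mem_iUnion]
    refine ⟨B, Finset.mem_powersetCard.2 ⟨Finset.subset_univ _, hBc⟩, ?_⟩
    rintro ⟨t, b, j⟩ hp
    simp only [Finset.mem_product, Finset.mem_singleton] at hp
    obtain ⟨rfl, hb, rfl⟩ := hp
    simpa using hB hb
  have h2 : ∀ B ∈ (Finset.univ : Finset (Fin n)).powersetCard k,
      (coinMeasure n).real {x : Coins n | ∀ p ∈ ({0} ×ˢ B ×ˢ {0} : Finset (ℕ × Fin n × ℕ)),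
          x p ∈ V} ≤ ((V.card : ℝ) / n) ^ k := by
    intro B hB
    rw [Finset.mem_powersetCard] at hB
    have := coinMeasure_real_forall_mem_le
      (I := ({0} ×ˢ B ×ˢ {0} : Finset (ℕ × Fin n × ℕ))) (J := ∅) (by simp)
      (V := fun _ => V) (fun _ _ _ => rfl) (w := V.card) fun _ => le_rfl
    simpa [hB.2] using this
  refine h1.trans ((Finset.sum_le_card_nsmul _ _ _ h2).trans ?_)
  have h3 : ((n.choose k : ℕ) : ℝ) ≤ (n : ℝ) ^ k / k.factorial := Nat.choose_le_pow_div k n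
  have h5 := pow_le_factorial_mul_exp k
  rw [Finset.card_powersetCard, Finset.card_univ, Fintype.card_fin, nsmul_eq_mul, ← pow_mul,
    mul_comm l, ← hk]
  refine (mul_le_mul_of_nonneg_right h3 (by positivity)).trans ?_
  have hl0 : (0 : ℝ) < l := by exact_mod_cast hl
  rw [div_pow, div_mul_div_comm, div_pow, div_le_div_iff₀ (by positivity) (by positivity)]
  have h6 : (k : ℝ) ^ k = (V.card : ℝ) ^ k * (l : ℝ) ^ k := by
    rw [← mul_pow]; congr 1; rw [hk]; push_cast; ring
  rw [h6] at h5
  calc (n : ℝ) ^ k * (V.card : ℝ) ^ k * (l : ℝ) ^ k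
      = n ^ k * ((V.card : ℝ) ^ k * (l : ℝ) ^ k) := by ring
    _ ≤ n ^ k * (k.factorial * Real.exp 1 ^ k) := by gcongr
    _ = _ := by ring

theorem prob_card_heavyBins_gt_le {l : ℕ} (hl : 1 ≤ l) {w : ℝ} (hw : 0 ≤ w)
    (h : 2 * Real.exp 1 * n * (Real.exp 1 / l) ^ l ≤ w) :
    (coinMeasure n).real {x : Coins n | w < (heavyBins l ∅ fun b => x (0, b, 0)).card} ≤
      (1 / 2 : ℝ) ^ w :=
  prob_card_gt_le (A := Finset.univ) (fun _ => Finset.subset_univ _) (by positivity) hw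
    (fun V _ => prob_subset_heavyBins_le hl V) (by simpa using h)

/-- A failing set `S` must land in the bins made heavy by the other balls, whose coins are
independent of those of `S`. Replacing this set of bins by `∅` when it exceeds `w` makes the size
bound hold surely, so that no conditioning on few heavy bins is needed. -/
theorem prob_first_subset_active_le (rule : ChoiceRule n) (l : ℕ) (s : Config n)
    {w : ℝ} (hw : 0 ≤ w) (S : Finset (Fin n)) :
    (coinMeasure n).real {x : Coins n |
      ((heavyBins l ∅ fun b => x (0, b, 0)).card : ℝ) ≤ w ∧
      S ⊆ activeBalls (roundStep rule l 1 (fun b j => x (0, b, j)) s)} ≤ (w / n) ^ S.card := by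
  classical
  let V : Coins n → Finset (Fin n) := fun x =>
    if ((heavyBins l S fun b => x (0, b, 0)).card : ℝ) ≤ w then
      heavyBins l S fun b => x (0, b, 0) else ∅
  have hd : Disjoint ({0} ×ˢ S ×ˢ {0} : Finset (ℕ × Fin n × ℕ)) ({0} ×ˢ Sᶜ ×ˢ Finset.range 1) := by
    rw [Finset.disjoint_left]
    simp only [Finset.mem_product, Finset.mem_compl]
    tauto
  have hVdep := dependsOn_roundCoins 0 1 Sᶜ (fun c : Fin n → ℕ → Fin n =>
    if ((heavyBins l S fun b => c b 0).card : ℝ) ≤ w then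
      heavyBins l S fun b => c b 0 else ∅) fun c c' hc => by
      have : (heavyBins l S fun b => c b 0) = heavyBins l S fun b => c' b 0 := by
        refine Finset.filter_congr fun v _ => ?_
        rw [Finset.filter_congr (q := fun b => c' b 0 = v) fun b hb => by
          simp only [hc b hb 0 one_pos]]
      simp only [this]
  have h := coinMeasure_real_forall_mem_le hd (V := V) hVdep (w := w) fun x => by
    by_cases hx : ((heavyBins l S fun b => x (0, b, 0)).card : ℝ) ≤ w
    · simp [V, hx]
    · simp [V, hx, hw]
  refine (measureReal_mono fun x hx p hp => ?_).trans (h.trans_eq (by simp))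
  obtain ⟨t, b, j⟩ := p
  simp only [Finset.mem_product, Finset.mem_singleton] at hp
  obtain ⟨rfl, hb, rfl⟩ := hp
  have hx' : ((heavyBins l S fun b => x (0, b, 0)).card : ℝ) ≤ w :=
    le_trans (by exact_mod_cast Finset.card_le_card (heavyBins_subset l S _)) hx.1
  simp only [V, hx', if_true]
  exact mem_heavyBins_of_fail hx.2 hb

theorem prob_first_card_active_gt_le (rule : ChoiceRule n) {l : ℕ} (hl : 1 ≤ l) (s : Config n)
    {w θ : ℝ} (hw : 0 ≤ w) (hθ : 0 ≤ θ) (h : 2 * Real.exp 1 * n * (Real.exp 1 / l) ^ l ≤ w)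
    (h' : 2 * Real.exp 1 * w ≤ θ) :
    (coinMeasure n).real {x : Coins n |
      θ < (activeBalls (roundStep rule l 1 (fun b j => x (0, b, j)) s)).card} ≤
      (1 / 2 : ℝ) ^ w + (1 / 2 : ℝ) ^ θ := by
  classical
  -- Emptying the set of survivors when there are too many heavy bins gives the subset bound for
  -- every nonempty `S`; the discarded event is paid for separately.
  let U : Coins n → Finset (Fin n) := fun x =>
    if ((heavyBins l ∅ fun b => x (0, b, 0)).card : ℝ) ≤ w then
      activeBalls (roundStep rule l 1 (fun b j => x (0, b, j)) s) else ∅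
  have hn : (0 : ℝ) < n := Nat.cast_pos.2 (NeZero.pos n)
  have hU := prob_card_gt_le (U := U) (A := Finset.univ) (fun _ => Finset.subset_univ _)
    (p := w / n) (by positivity) hθ (fun S _ => by
      rcases S.eq_empty_or_nonempty with rfl | hS
      · simp
      refine (measureReal_mono fun x hx => ?_).trans (prob_first_subset_active_le rule l s hw S)
      by_cases hx' : ((heavyBins l ∅ fun b => x (0, b, 0)).card : ℝ) ≤ w
      · exact ⟨hx', by simpa [U, hx'] using hx⟩
      · simp only [U, hx', if_false, Set.mem_ofPred_eq, Finset.subset_empty] at hx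
        exact absurd hx hS.ne_empty)
    (by rw [Finset.card_univ, Fintype.card_fin]; field_simp; linarith)
  refine (measureReal_mono (s₂ := {x : Coins n | w < (heavyBins l ∅ fun b => x (0, b, 0)).card} ∪
    {x | θ < (U x).card}) (fun x hx => ?_) (measure_ne_top _ _)).trans
    ((measureReal_union_le _ _).trans (add_le_add (prob_card_heavyBins_gt_le hl hw h) hU))
  by_cases hx' : ((heavyBins l ∅ fun b => x (0, b, 0)).card : ℝ) ≤ w
  · right; simpa [U, hx'] using hx
  · left; exact not_le.1 hx'

theorem prob_first_mem_active_le (rule : ChoiceRule n) {l : ℕ} (hl : 1 ≤ l) (s : Config n)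
    {w : ℝ} (hw : 0 ≤ w) (h : 2 * Real.exp 1 * n * (Real.exp 1 / l) ^ l ≤ w) (b : Fin n) :
    (coinMeasure n).real {x : Coins n |
      b ∈ activeBalls (roundStep rule l 1 (fun b j => x (0, b, j)) s)} ≤
      (1 / 2 : ℝ) ^ w + w / n := by
  have h1 := prob_first_subset_active_le rule l s hw {b}
  rw [Finset.card_singleton, pow_one] at h1
  refine (measureReal_mono fun x hx => ?_).trans
    ((measureReal_union_le _ _).trans (add_le_add (prob_card_heavyBins_gt_le hl hw h) h1))
  by_cases hx' : ((heavyBins l ∅ fun b => x (0, b, 0)).card : ℝ) ≤ w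
  · right; exact ⟨hx', by simpa using hx⟩
  · left; exact not_le.1 hx'

/-! ### Requests received by a bin -/

theorem lintegral_pow_sum_count (m t : ℕ) (s : Config n) (v : Fin n) (y : ENNReal) :
    ∫⁻ x, (1 + y) ^ (∑ b, (roundRequests m (fun b j => x (t, b, j)) s b).count v)
      ∂coinMeasure n = (1 + y / n) ^ ((activeBalls s).card * m) := by
  simp_rw [sum_count_roundRequests, lintegral_pow_card_coins]
  simp

theorem lintegral_sum_count (m t : ℕ) (s : Config n) (v : Fin n) :
    ∫⁻ x, ((∑ b, (roundRequests m (fun b j => x (t, b, j)) s b).count v : ℕ) : ENNReal)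
      ∂coinMeasure n = ((activeBalls s).card * m : ℕ) / n := by
  simp_rw [sum_count_roundRequests, lintegral_card_coins]
  simp

end OneRound

/-! ### The process over several rounds -/

section Evolution

variable {n : ℕ}

theorem run_succ (A : Schedule) (rule : ChoiceRule n) (ω : Coins n) (t : ℕ) :
    run A rule ω (t + 1) =
      roundStep rule (A.cap t) (A.req t) (fun b j => ω (t, b, j)) (run A rule ω t) := rfl

theorem run_succ_eq_nextConfig (A : Schedule) (rule : ChoiceRule n) (ω : Coins n) (t : ℕ) :
    run A rule ω (t + 1) =
      nextConfig rule (A.cap t) (run A rule ω t) (requestsAt A rule ω t) := rfl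

/-- The positions of the coins that are used before round `t`. -/
def coinsBefore (n : ℕ) (A : Schedule) (t : ℕ) : Finset (ℕ × Fin n × ℕ) :=
  (Finset.range t).biUnion fun i => {i} ×ˢ Finset.univ ×ˢ Finset.range (A.req i)

theorem mem_coinsBefore {A : Schedule} {t : ℕ} {p : ℕ × Fin n × ℕ} :
    p ∈ coinsBefore n A t ↔ p.1 < t ∧ p.2.2 < A.req p.1 := by
  obtain ⟨i, b, j⟩ := p
  simp only [coinsBefore, Finset.mem_biUnion, Finset.mem_range, Finset.mem_product,
    Finset.mem_singleton, Finset.mem_univ, true_and]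
  constructor
  · rintro ⟨i', hi', rfl, hj⟩
    exact ⟨hi', hj⟩
  · rintro ⟨hi, hj⟩
    exact ⟨i, hi, rfl, hj⟩

theorem coinsBefore_mono (A : Schedule) {s t : ℕ} (h : s ≤ t) :
    coinsBefore n A s ⊆ coinsBefore n A t := by
  intro p hp
  rw [mem_coinsBefore] at hp ⊢
  exact ⟨hp.1.trans_le h, hp.2⟩

theorem coinsBefore_mono_set (A : Schedule) {s t : ℕ} (h : s ≤ t) :
    (coinsBefore n A s : Set (ℕ × Fin n × ℕ)) ⊆ coinsBefore n A t :=
  Finset.coe_subset.2 (coinsBefore_mono A h)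

theorem dependsOn_run (A : Schedule) (rule : ChoiceRule n) (t : ℕ) :
    DependsOn (fun ω => run A rule ω t) (coinsBefore n A t : Set (ℕ × Fin n × ℕ)) := by
  induction t with
  | zero => intro _ _ _; rfl
  | succ t ih =>
    intro ω ω' h
    have h1 : run A rule ω t = run A rule ω' t :=
      ih fun p hp => h p (coinsBefore_mono_set A t.le_succ hp)
    change run A rule ω (t + 1) = run A rule ω' (t + 1)
    rw [run_succ, run_succ, h1, roundStep_eq, roundStep_eq]
    congr 1
    refine roundRequests_congr fun b _ j hj => h _ ?_
    exact Finset.mem_coe.2 (mem_coinsBefore.2 ⟨t.lt_succ_self, hj⟩)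

theorem dependsOn_run_le (A : Schedule) (rule : ChoiceRule n) {s t : ℕ} (h : s ≤ t) :
    DependsOn (fun ω => run A rule ω s) (coinsBefore n A t : Set (ℕ × Fin n × ℕ)) :=
  (dependsOn_run A rule s).mono (coinsBefore_mono_set A h)

theorem dependsOn_requestsAt (A : Schedule) (rule : ChoiceRule n) (t : ℕ) :
    DependsOn (fun ω => requestsAt A rule ω t)
      (coinsBefore n A (t + 1) : Set (ℕ × Fin n × ℕ)) := by
  intro ω ω' h
  have h1 : run A rule ω t = run A rule ω' t :=
    dependsOn_run_le A rule t.le_succ h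
  simp only [requestsAt, h1]
  refine roundRequests_congr fun b _ j hj => h _ ?_
  exact Finset.mem_coe.2 (mem_coinsBefore.2 ⟨t.lt_succ_self, hj⟩)

/-! ### Deterministic facts -/

theorem activeBalls_run_zero (A : Schedule) (rule : ChoiceRule n) (ω : Coins n) :
    activeBalls (run A rule ω 0) = Finset.univ := by
  simp [activeBalls, run]

theorem activeBalls_run_antitone (A : Schedule) (rule : ChoiceRule n) (ω : Coins n) :
    Antitone fun t => activeBalls (run A rule ω t) :=
  antitone_nat_of_succ_le fun _ => activeBalls_nextConfig_subset _ _ _ _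

theorem card_activeBalls_run_antitone (A : Schedule) (rule : ChoiceRule n) (ω : Coins n) :
    Antitone fun t => (activeBalls (run A rule ω t)).card :=
  fun _ _ h => Finset.card_le_card (activeBalls_run_antitone A rule ω h)

theorem length_requestsAt (A : Schedule) (rule : ChoiceRule n) (ω : Coins n) (t : ℕ)
    (b : Fin n) : (requestsAt A rule ω t b).length =
      if b ∈ activeBalls (run A rule ω t) then A.req t else 0 := by
  by_cases h : (run A rule ω t).place b = none <;>
    simp [requestsAt, roundRequests, activeBalls, h]

theorem totalRequests_eq (A : Schedule) (rule : ChoiceRule n) (ω : Coins n) (t : ℕ) :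
    totalRequests A rule ω t = (activeBalls (run A rule ω t)).card * A.req t := by
  simp only [totalRequests, length_requestsAt]
  simp

theorem terminatedBy_iff {A : Schedule} {rule : ChoiceRule n} {ω : Coins n} {t : ℕ} :
    TerminatedBy A rule ω t ↔ activeBalls (run A rule ω t) = ∅ := by
  simp [TerminatedBy, activeBalls, Finset.filter_eq_empty_iff]

theorem TerminatedBy.mono {A : Schedule} {rule : ChoiceRule n} {ω : Coins n} {s t : ℕ}
    (h : TerminatedBy A rule ω s) (hst : s ≤ t) : TerminatedBy A rule ω t := by
  rw [terminatedBy_iff] at h ⊢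
  exact Finset.subset_empty.1 (h ▸ activeBalls_run_antitone A rule ω hst)

/-- As long as there are active balls, one of them is placed. -/
theorem card_activeBalls_succ_lt {A : Schedule} {rule : ChoiceRule n} {ω : Coins n} {t : ℕ}
    (hcap : 1 ≤ A.cap t) (hreq : 1 ≤ A.req t) (h : ¬ TerminatedBy A rule ω t) :
    (activeBalls (run A rule ω (t + 1))).card < (activeBalls (run A rule ω t)).card := by
  refine Finset.card_lt_card ((activeBalls_run_antitone A rule ω t.le_succ).lt_of_ne fun heq => ?_)
  rw [terminatedBy_iff, ← Ne, ← Finset.nonempty_iff_ne_empty] at h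
  obtain ⟨b, hb⟩ := h
  have heq' : activeBalls (run A rule ω (t + 1)) = activeBalls (run A rule ω t) := heq
  have := mem_contactedOutside_of_fail (rule := rule) (m := A.req t)
    (coins := fun b j => ω (t, b, j)) (s := run A rule ω t)
    (S := activeBalls (run A rule ω t)) hcap (by rw [← run_succ, heq']) hb
    (show 0 < A.req t from hreq)
  simp [contactedOutside] at this

/-- Each round places at least one ball for every outcome of the coins. This sure bound of `n`
rounds reduces the supremum over all times, in the expectation part, to the first `n` rounds. -/
theorem terminatedBy_self {A : Schedule} (rule : ChoiceRule n) (ω : Coins n)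
    (hcap : ∀ t, 1 ≤ A.cap t) (hreq : ∀ t, 1 ≤ A.req t) : TerminatedBy A rule ω n := by
  have h : ∀ t, TerminatedBy A rule ω t ∨ (activeBalls (run A rule ω t)).card + t ≤ n := by
    intro t
    induction t with
    | zero => right; simp [activeBalls_run_zero]
    | succ t ih =>
      by_cases ht : TerminatedBy A rule ω t
      · exact Or.inl (ht.mono t.le_succ)
      · have := card_activeBalls_succ_lt (hcap t) (hreq t) ht
        rcases ih with ih | ih
        · exact absurd ih ht
        · right; omega
  rcases h n with h | h
  · exact h
  · rw [terminatedBy_iff, ← Finset.card_eq_zero]; omega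

theorem run_place_succ {A : Schedule} {rule : ChoiceRule n} {ω : Coins n} {t : ℕ} {b v : Fin n}
    (h : (run A rule ω t).place b = some v) : (run A rule ω (t + 1)).place b = some v := by
  simp [run_succ, roundStep, h]

theorem mem_grant_of_place_succ {A : Schedule} {rule : ChoiceRule n} {ω : Coins n} {t : ℕ}
    {b v : Fin n} (h : (run A rule ω (t + 1)).place b = some v)
    (hb : (run A rule ω t).place b = none) :
    b ∈ rule.grant (requestsAt A rule ω t :: (run A rule ω t).history) (A.cap t) v
      (requesters (requestsAt A rule ω t) v) := by
  rw [run_succ_eq_nextConfig] at h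
  simp only [nextConfig, hb, if_true] at h
  split_ifs at h with hne
  have := rule.choose_mem (requestsAt A rule ω t :: (run A rule ω t).history) b _ hne
  rw [Option.some.inj h] at this
  simpa [permissions] using this

theorem load_succ_le_add_card_grant (A : Schedule) (rule : ChoiceRule n) (ω : Coins n) (t : ℕ)
    (v : Fin n) : load A rule ω (t + 1) v ≤ load A rule ω t v +
      (rule.grant (requestsAt A rule ω t :: (run A rule ω t).history) (A.cap t) v
        (requesters (requestsAt A rule ω t) v)).card := by
  refine (Finset.card_le_card fun b hb => ?_).trans (Finset.card_union_le _ _)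
  simp only [Finset.mem_union, Finset.mem_filter, Finset.mem_univ, true_and] at hb ⊢
  rcases hp : (run A rule ω t).place b with _ | v'
  · exact Or.inr (mem_grant_of_place_succ hb hp)
  · rw [run_place_succ hp] at hb
    exact Or.inl hb

theorem load_succ_le (A : Schedule) (rule : ChoiceRule n) (ω : Coins n) (t : ℕ) (v : Fin n) :
    load A rule ω (t + 1) v ≤ load A rule ω t v + A.cap t := by
  refine (load_succ_le_add_card_grant A rule ω t v).trans (Nat.add_le_add_left ?_ _)
  rw [rule.card_grant]
  exact min_le_left _ _

theorem load_zero (A : Schedule) (rule : ChoiceRule n) (ω : Coins n) (v : Fin n) :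
    load A rule ω 0 v = 0 := by
  simp [load, run]

theorem load_le_sum_cap (A : Schedule) (rule : ChoiceRule n) (ω : Coins n) (t : ℕ) (v : Fin n) :
    load A rule ω t v ≤ ∑ j ∈ Finset.range t, A.cap j := by
  induction t with
  | zero => simp [load_zero]
  | succ t ih =>
    rw [Finset.sum_range_succ]
    exact (load_succ_le A rule ω t v).trans (Nat.add_le_add_right ih _)

/-- A ball placed in `v` has requested `v` in that same round, so notifications are dominated by
requests. -/
theorem load_le_binRequests (A : Schedule) (rule : ChoiceRule n) (ω : Coins n) (t : ℕ)
    (v : Fin n) : load A rule ω t v ≤ binRequests A rule ω t v := by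
  induction t with
  | zero => simp [load_zero]
  | succ t ih =>
    rw [binRequests, Finset.sum_range_succ]
    refine (load_succ_le_add_card_grant A rule ω t v).trans (Nat.add_le_add ih ?_)
    rw [rule.card_grant]
    refine (min_le_right _ _).trans ?_
    rw [requesters, Finset.card_filter]
    refine Finset.sum_le_sum fun b _ => ?_
    split_ifs with h
    · exact List.count_pos_iff.2 h
    · exact Nat.zero_le _

theorem binMessages_le (A : Schedule) (rule : ChoiceRule n) (ω : Coins n) (t : ℕ) (v : Fin n) :
    binMessages A rule ω t v ≤ 3 * binRequests A rule ω t v := by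
  have := load_le_binRequests A rule ω t v
  rw [binMessages]; omega

theorem requestsAt_eq_nil {A : Schedule} {rule : ChoiceRule n} {ω : Coins n} {T t : ℕ}
    (h : TerminatedBy A rule ω T) (hT : T ≤ t) (b : Fin n) : requestsAt A rule ω t b = [] := by
  simp [requestsAt, roundRequests, h.mono hT b]

theorem sum_range_le_of_eq_zero {f : ℕ → ℕ} {T : ℕ} (hf : ∀ j, T ≤ j → f j = 0) (t : ℕ) :
    ∑ j ∈ Finset.range t, f j ≤ ∑ j ∈ Finset.range T, f j := by
  rw [← Finset.sum_subset (Finset.range_mono (min_le_left t T)) (f := f) fun j hj hj' =>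
    hf j (by simp at hj hj'; omega)]
  exact Finset.sum_le_sum_of_subset (Finset.range_mono (min_le_right t T))

theorem ballRequests_le_of_terminatedBy {A : Schedule} {rule : ChoiceRule n} {ω : Coins n} {T : ℕ}
    (h : TerminatedBy A rule ω T) (t : ℕ) (b : Fin n) :
    ballRequests A rule ω t b ≤ ballRequests A rule ω T b :=
  sum_range_le_of_eq_zero (fun j hj => by simp [requestsAt_eq_nil h hj]) t

theorem binRequests_le_of_terminatedBy {A : Schedule} {rule : ChoiceRule n} {ω : Coins n} {T : ℕ}
    (h : TerminatedBy A rule ω T) (t : ℕ) (v : Fin n) :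
    binRequests A rule ω t v ≤ binRequests A rule ω T v :=
  sum_range_le_of_eq_zero (fun j hj => by simp [requestsAt_eq_nil h hj]) t

theorem load_mono (A : Schedule) (rule : ChoiceRule n) (ω : Coins n) (v : Fin n) :
    Monotone fun t => load A rule ω t v :=
  monotone_nat_of_le_succ fun t => Finset.card_le_card fun b hb => by
    simp only [Finset.mem_filter, Finset.mem_univ, true_and] at hb ⊢
    exact run_place_succ hb

theorem load_le_of_terminatedBy {A : Schedule} {rule : ChoiceRule n} {ω : Coins n} {T : ℕ}
    (h : TerminatedBy A rule ω T) (t : ℕ) (v : Fin n) :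
    load A rule ω t v ≤ load A rule ω T v := by
  rcases le_total t T with hle | hle
  · exact load_mono A rule ω v hle
  · refine Nat.le_induction le_rfl (fun t ht ih => ?_) t hle
    refine (Finset.card_le_card fun b hb => ?_).trans ih
    simp only [Finset.mem_filter, Finset.mem_univ, true_and] at hb ⊢
    rcases hp : (run A rule ω t).place b with _ | v'
    · exact absurd hp (h.mono ht b)
    · rw [run_place_succ hp] at hb
      exact hb

theorem ballRequests_le_sum_req (A : Schedule) (rule : ChoiceRule n) (ω : Coins n) (t : ℕ)
    (b : Fin n) : ballRequests A rule ω t b ≤ ∑ j ∈ Finset.range t, A.req j := by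
  refine Finset.sum_le_sum fun j _ => ?_
  rw [length_requestsAt]
  split_ifs <;> simp

theorem ballMessages_le (A : Schedule) (rule : ChoiceRule n) (ω : Coins n) (t : ℕ) (b : Fin n) :
    ballMessages A rule ω t b ≤ 2 * ballRequests A rule ω t b + 1 := by
  rw [ballMessages]
  split_ifs <;> omega

theorem sum_ballRequests (A : Schedule) (rule : ChoiceRule n) (ω : Coins n) (t : ℕ) :
    ∑ b, ballRequests A rule ω t b = ∑ j ∈ Finset.range t, totalRequests A rule ω j := by
  simp only [ballRequests, totalRequests]
  exact Finset.sum_comm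

theorem totalMessages_le (A : Schedule) (rule : ChoiceRule n) (ω : Coins n) (t : ℕ) :
    totalMessages A rule ω t ≤ 2 * ∑ j ∈ Finset.range t, totalRequests A rule ω j + n := by
  refine (Finset.sum_le_sum fun b _ => ballMessages_le A rule ω t b).trans_eq ?_
  rw [Finset.sum_add_distrib, ← Finset.mul_sum, sum_ballRequests]
  simp

theorem binRequests_le_sum_totalRequests (A : Schedule) (rule : ChoiceRule n) (ω : Coins n)
    (t : ℕ) (v : Fin n) :
    binRequests A rule ω t v ≤ ∑ j ∈ Finset.range t, totalRequests A rule ω j :=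
  Finset.sum_le_sum fun _ _ => Finset.sum_le_sum fun _ _ => List.count_le_length

variable [NeZero n]

/-! ### Conditioning on the past -/

/-- Given what happened before round `t`, the coins of round `t` are fresh. -/
theorem lintegral_requestsAt (A : Schedule) (rule : ChoiceRule n) (t : ℕ)
    {φ : Coins n → Requests n → ENNReal}
    (hφ : ∀ q, DependsOn (fun ω => φ ω q) (coinsBefore n A t : Set (ℕ × Fin n × ℕ))) :
    ∫⁻ ω, φ ω (requestsAt A rule ω t) ∂coinMeasure n =
      ∫⁻ ω, ∫⁻ x, φ ω (roundRequests (A.req t) (fun b j => x (t, b, j)) (run A rule ω t))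
        ∂coinMeasure n ∂coinMeasure n := by
  have hd : Disjoint ({t} ×ˢ Finset.univ ×ˢ Finset.range (A.req t) : Finset (ℕ × Fin n × ℕ))
      (coinsBefore n A t) := by
    rw [Finset.disjoint_left]
    rintro ⟨i, b, j⟩ hp hq
    simp only [Finset.mem_product, Finset.mem_singleton] at hp
    rw [mem_coinsBefore] at hq
    exact hq.1.ne hp.1
  refine lintegral_resample hd (F := fun x y =>
    φ y (roundRequests (A.req t) (fun b j => x (t, b, j)) (run A rule y t))) (fun y => ?_)
    fun x ω ω' h => ?_
  · exact dependsOn_roundCoins t (A.req t) Finset.univ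
      (fun c => φ y (roundRequests (A.req t) c (run A rule y t))) fun c c' hc => by
        rw [roundRequests_congr fun b _ j hj => hc b (Finset.mem_univ b) j hj]
  · have h1 : run A rule ω t = run A rule ω' t := dependsOn_run A rule t h
    simp only [h1]
    exact hφ _ h

theorem measurableSet_of_dependsOn {P : Coins n → Prop} {S : Finset (ℕ × Fin n × ℕ)}
    (h : DependsOn P (S : Set (ℕ × Fin n × ℕ))) : MeasurableSet {ω | P ω} :=
  (measurable_of_dependsOn h).setOf

theorem lintegral_ite_eq_measure {P : Coins n → Prop} [DecidablePred P]
    {S : Finset (ℕ × Fin n × ℕ)} (h : DependsOn P (S : Set (ℕ × Fin n × ℕ))) :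
    ∫⁻ ω, (if P ω then 1 else 0) ∂coinMeasure n = coinMeasure n {ω | P ω} := by
  rw [← lintegral_indicator_one (measurableSet_of_dependsOn h)]
  exact lintegral_congr fun ω => by simp [Set.indicator]

/-- If in round `t` an event has probability at most `ε` whatever happened before, provided that
`P` holds, then this remains true after intersecting with `P`. -/
theorem prob_and_run_succ_le (A : Schedule) (rule : ChoiceRule n) (t : ℕ) {P : Coins n → Prop}
    (hP : DependsOn P (coinsBefore n A t : Set (ℕ × Fin n × ℕ))) (Q : Config n → Prop) {ε : ℝ}
    (hε : 0 ≤ ε)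
    (h : ∀ ω, P ω → (coinMeasure n).real {x : Coins n |
      Q (roundStep rule (A.cap t) (A.req t) (fun b j => x (t, b, j)) (run A rule ω t))} ≤ ε) :
    (coinMeasure n).real {ω | P ω ∧ Q (run A rule ω (t + 1))} ≤
      ε * (coinMeasure n).real {ω | P ω} := by
  classical
  have h0 : DependsOn (fun ω => P ω ∧ Q (run A rule ω (t + 1)))
      (coinsBefore n A (t + 1) : Set (ℕ × Fin n × ℕ)) := fun ω ω' hω => by
    have h1 := hP.mono (coinsBefore_mono_set A t.le_succ) hω
    have h2 : run A rule ω (t + 1) = run A rule ω' (t + 1) := dependsOn_run A rule (t + 1) hω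
    simp only [h1, h2]
  let φ : Coins n → Requests n → ENNReal := fun ω q =>
    if P ω ∧ Q (nextConfig rule (A.cap t) (run A rule ω t) q) then 1 else 0
  have hφ : ∀ q, DependsOn (fun ω => φ ω q) (coinsBefore n A t : Set (ℕ × Fin n × ℕ)) := by
    intro q ω ω' hω
    have h1 := hP hω
    have h2 : run A rule ω t = run A rule ω' t := dependsOn_run A rule t hω
    simp only [φ, h1, h2]
  have h3 : coinMeasure n {ω | P ω ∧ Q (run A rule ω (t + 1))} ≤
      ENNReal.ofReal ε * coinMeasure n {ω | P ω} := by
    rw [← lintegral_ite_eq_measure h0, ← lintegral_ite_eq_measure hP,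
      ← lintegral_const_mul' _ _ ENNReal.ofReal_ne_top]
    refine (lintegral_requestsAt A rule t hφ).trans_le (lintegral_mono fun ω => ?_)
    by_cases hω : P ω
    · simp only [φ, hω, true_and, if_true, mul_one]
      have hdep : DependsOn (fun x : Coins n =>
          Q (nextConfig rule (A.cap t) (run A rule ω t)
            (roundRequests (A.req t) (fun b j => x (t, b, j)) (run A rule ω t)))) _ :=
        dependsOn_roundCoins t (A.req t) Finset.univ
          (fun c => Q (nextConfig rule (A.cap t) (run A rule ω t)
            (roundRequests (A.req t) c (run A rule ω t)))) fun c c' hc => by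
          rw [roundRequests_congr fun b _ j hj => hc b (Finset.mem_univ b) j hj]
      rw [lintegral_ite_eq_measure hdep]
      exact (ENNReal.le_ofReal_iff_toReal_le (measure_ne_top _ _) hε).2 (h ω hω)
    · simp [φ, hω]
  have h4 := ENNReal.toReal_mono (ENNReal.mul_ne_top ENNReal.ofReal_ne_top (measure_ne_top _ _)) h3
  rwa [ENNReal.toReal_mul, ENNReal.toReal_ofReal hε] at h4

end Evolution

/-! ### The invariant on the number of requests and its propagation -/

section Chaining

variable {n : ℕ}

/-- In the rounds `1, …, t`, at most `η n` requests are sent when active balls send `k j`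
requests each. -/
def FewRequests (A : Schedule) (rule : ChoiceRule n) (k : ℕ → ℝ) (η : ℝ) (t : ℕ) (ω : Coins n) :
    Prop :=
  ∀ j, 1 ≤ j → j ≤ t → (activeBalls (run A rule ω j)).card * k j ≤ η * n

theorem FewRequests.mono {A : Schedule} {rule : ChoiceRule n} {k : ℕ → ℝ} {η : ℝ} {s t : ℕ}
    {ω : Coins n} (h : FewRequests A rule k η t ω) (hst : s ≤ t) : FewRequests A rule k η s ω :=
  fun j hj hjs => h j hj (hjs.trans hst)

/-- Once `k` is constant, the product with the nonincreasing number of active balls cannot grow, so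
checking the rounds up to `r` suffices for all times. -/
theorem FewRequests.of_eventually_const {A : Schedule} {rule : ChoiceRule n} {k : ℕ → ℝ} {η : ℝ}
    {r : ℕ} (hr : 1 ≤ r) {ω : Coins n} (hk0 : ∀ j, 0 ≤ k j) (hk : ∀ j, r ≤ j → k j = k r)
    (h : FewRequests A rule k η r ω) (t : ℕ) : FewRequests A rule k η t ω := by
  intro j hj _
  rcases le_total j r with hjr | hjr
  · exact h j hj hjr
  · refine le_trans ?_ (h r hr le_rfl)
    rw [hk j hjr]
    exact mul_le_mul_of_nonneg_right
      (by exact_mod_cast card_activeBalls_run_antitone A rule ω hjr) (hk0 r)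

theorem dependsOn_fewRequests (A : Schedule) (rule : ChoiceRule n) (k : ℕ → ℝ) (η : ℝ) (t : ℕ) :
    DependsOn (FewRequests A rule k η t) (coinsBefore n A t : Set (ℕ × Fin n × ℕ)) := by
  intro ω ω' h
  refine propext (forall_congr' fun j => forall₂_congr fun _ hj => ?_)
  have : run A rule ω j = run A rule ω' j := dependsOn_run_le A rule hj h
  rw [this]

theorem dependsOn_and_mem_active (A : Schedule) (rule : ChoiceRule n) {t : ℕ}
    {P : Coins n → Prop} (hP : DependsOn P (coinsBefore n A t : Set (ℕ × Fin n × ℕ)))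
    (b : Fin n) :
    DependsOn (fun ω => P ω ∧ b ∈ activeBalls (run A rule ω t))
      (coinsBefore n A t : Set (ℕ × Fin n × ℕ)) := by
  intro ω ω' h
  have h1 := hP h
  have h2 : run A rule ω t = run A rule ω' t := dependsOn_run A rule t h
  simp only [h1, h2]

/-- The assumptions on the numbers of requests that drive the analysis. -/
structure Growing (A : Schedule) (k : ℕ → ℝ) : Prop where
  cap : ∀ t, 1 ≤ A.cap t
  req : ∀ t, A.req t = ⌊k t⌋₊
  zero : k 0 = 1
  one_le : ∀ t, 1 ≤ k t
  succ_le : ∀ t, 1 ≤ t → k (t + 1) ≤ k t * Real.exp ((A.req t : ℝ) / 5)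

theorem Growing.one_le_req {A : Schedule} {k : ℕ → ℝ} (h : Growing A k) (t : ℕ) :
    1 ≤ A.req t := by
  rw [h.req, Nat.le_floor_iff' one_ne_zero]
  exact_mod_cast h.one_le t

theorem Growing.pos {A : Schedule} {k : ℕ → ℝ} (h : Growing A k) (t : ℕ) : 0 < k t :=
  one_pos.trans_le (h.one_le t)

theorem Growing.req_le {A : Schedule} {k : ℕ → ℝ} (h : Growing A k) (t : ℕ) :
    (A.req t : ℝ) ≤ k t := by
  rw [h.req]
  exact Nat.floor_le (h.pos t).le

theorem Growing.req_zero {A : Schedule} {k : ℕ → ℝ} (h : Growing A k) : A.req 0 = 1 := by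
  rw [h.req, h.zero]; simp

theorem FewRequests.card_mul_req_le {A : Schedule} {rule : ChoiceRule n} {k : ℕ → ℝ} {η : ℝ}
    {t : ℕ} {ω : Coins n} (hA : Growing A k) (ht : 1 ≤ t) (h : FewRequests A rule k η t ω) :
    ((activeBalls (run A rule ω t)).card * A.req t : ℝ) ≤ η * n :=
  (mul_le_mul_of_nonneg_left (hA.req_le t) (Nat.cast_nonneg _)).trans (h t ht le_rfl)

theorem binRequests_succ (A : Schedule) (rule : ChoiceRule n) (ω : Coins n) (t : ℕ) (v : Fin n) :
    binRequests A rule ω (t + 1) v =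
      binRequests A rule ω t v + ∑ b, (requestsAt A rule ω t b).count v :=
  Finset.sum_range_succ _ _

theorem dependsOn_binRequests (A : Schedule) (rule : ChoiceRule n) (t : ℕ) (v : Fin n) :
    DependsOn (fun ω => binRequests A rule ω t v)
      (coinsBefore n A t : Set (ℕ × Fin n × ℕ)) := by
  intro ω ω' h
  refine Finset.sum_congr rfl fun j hj => ?_
  have : requestsAt A rule ω j = requestsAt A rule ω' j :=
    (dependsOn_requestsAt A rule j).mono (coinsBefore_mono_set A (Finset.mem_range.1 hj)) h
  simp only [this]

variable [NeZero n]

/-- The survival probability of a ball in a round in which at most `κ n` requests are sent. -/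
theorem prob_and_mem_active_succ_le (A : Schedule) (rule : ChoiceRule n) {t : ℕ}
    (hcap : 1 ≤ A.cap t) {P : Coins n → Prop}
    (hP : DependsOn P (coinsBefore n A t : Set (ℕ × Fin n × ℕ))) {κ : ℝ} (hκ : 0 ≤ κ)
    (h : ∀ ω, P ω → ((activeBalls (run A rule ω t)).card * A.req t : ℝ) ≤ κ * n) (b : Fin n) :
    (coinMeasure n).real {ω | P ω ∧ b ∈ activeBalls (run A rule ω (t + 1))} ≤
      κ ^ A.req t * (coinMeasure n).real {ω | P ω ∧ b ∈ activeBalls (run A rule ω t)} := by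
  have hn : (0 : ℝ) < n := Nat.cast_pos.2 (NeZero.pos n)
  refine (measureReal_mono fun ω hω => ?_).trans
    (prob_and_run_succ_le A rule t (dependsOn_and_mem_active A rule hP b)
      (fun s => b ∈ activeBalls s) (pow_nonneg hκ _) fun ω hω => ?_)
  -- Survival past round `t` includes survival up to round `t`; adding this to the conditioning
  -- event is what yields a product bound.
  · exact ⟨⟨hω.1, activeBalls_run_antitone A rule ω t.le_succ hω.2⟩, hω.2⟩
  · have h1 := prob_subset_active_le rule hcap (A.req t) t (run A rule ω t) {b}
    rw [Finset.card_singleton, pow_one] at h1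
    simp only [Finset.singleton_subset_iff] at h1
    refine h1.trans (pow_le_pow_left₀ (by positivity) ?_ _)
    rw [div_le_iff₀ hn]
    exact h ω hω.1

theorem prob_and_card_active_gt_le (A : Schedule) (rule : ChoiceRule n) {t : ℕ}
    (hcap : 1 ≤ A.cap t) {P : Coins n → Prop}
    (hP : DependsOn P (coinsBefore n A t : Set (ℕ × Fin n × ℕ))) {κ a θ : ℝ}
    (hθ : 0 ≤ θ)
    (h : ∀ ω, P ω → ((activeBalls (run A rule ω t)).card * A.req t : ℝ) ≤ κ * n)
    (ha : ∀ ω, P ω → ((activeBalls (run A rule ω t)).card : ℝ) ≤ a)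
    (haθ : 2 * Real.exp 1 * a * κ ^ A.req t ≤ θ) :
    (coinMeasure n).real {ω | P ω ∧ θ < (activeBalls (run A rule ω (t + 1))).card} ≤
      (1 / 2 : ℝ) ^ θ := by
  have hn : (0 : ℝ) < n := Nat.cast_pos.2 (NeZero.pos n)
  refine (prob_and_run_succ_le A rule t hP (fun s => θ < (activeBalls s).card) (by positivity)
    fun ω hω => prob_card_active_gt_le rule hcap (A.req t) t (run A rule ω t) hθ
      (le_trans ?_ haθ)).trans
    (mul_le_of_le_one_right (by positivity) measureReal_le_one)
  have ha0 : 0 ≤ a := (Nat.cast_nonneg _).trans (ha ω hω)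
  gcongr
  · exact ha ω hω
  · rw [div_le_iff₀ hn]
    exact h ω hω

/-- Numerically, `η e^(1/5) ≤ (1/8)(5/4) = 5/32` and `2 e · 5/32 < 1`. This is where the growth rate
`e ^ (⌊k⌋ / 5)` is matched with `η ≤ 1/8`; the factor `2 e` is the loss in the union bound over sets
of survivors. -/
theorem two_exp_mul_pow_le_one {η : ℝ} (hη0 : 0 ≤ η) (hη : η ≤ 1 / 8) {m : ℕ} (hm : 1 ≤ m) :
    2 * Real.exp 1 * (η ^ m * Real.exp ((m : ℝ) / 5)) ≤ 1 := by
  have h1 : Real.exp ((m : ℝ) / 5) = Real.exp (1 / 5) ^ m := by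
    rw [← Real.exp_nat_mul]; congr 1; ring
  have h2 : Real.exp (1 / 5 : ℝ) ≤ 5 / 4 := by
    -- The case `1 - 1/5 ≤ e^(-1/5)`, inverted.
    have := Real.one_sub_div_pow_le_exp_neg (n := 1) (t := 1 / 5) (by norm_num)
    rw [Real.exp_neg] at this
    norm_num at this
    rw [le_inv_comm₀ (by norm_num) (by positivity)] at this
    norm_num at this ⊢
    exact this
  have h3 := Real.exp_one_lt_d9
  have h4 : η * Real.exp (1 / 5) ≤ 5 / 32 := by
    calc _ ≤ 1 / 8 * (5 / 4 : ℝ) := by gcongr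
      _ = _ := by norm_num
  have h5 : (η * Real.exp (1 / 5)) ^ m ≤ 5 / 32 :=
    (pow_le_of_le_one (by positivity) (h4.trans (by norm_num)) (by omega)).trans h4
  rw [h1, ← mul_pow]
  have h6 : 0 ≤ (η * Real.exp (1 / 5)) ^ m := by positivity
  nlinarith [Real.exp_pos 1]

/-- From at most `η n / k t` balls, each surviving with weight `η ^ m`, the union bound leaves `2 e
η ^ m · η n / k t`. By `two_exp_mul_pow_le_one` this is at most `η n / k (t + 1)`, since `k` grows
by at most `e ^ (m / 5)`. -/
theorem prob_fewRequests_fails_in_round_le {A : Schedule} {k : ℕ → ℝ} (hA : Growing A k)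
    (rule : ChoiceRule n) {η : ℝ} (hη0 : 0 ≤ η) (hη : η ≤ 1 / 8) {t : ℕ} (ht : 1 ≤ t) :
    (coinMeasure n).real {ω | FewRequests A rule k η t ω ∧
      η * n / k (t + 1) < (activeBalls (run A rule ω (t + 1))).card} ≤
      (1 / 2 : ℝ) ^ (η * n / k (t + 1)) := by
  have hk := hA.pos
  refine prob_and_card_active_gt_le A rule (hA.cap t) (dependsOn_fewRequests A rule k η t)
    (a := η * n / k t) (by have := hk (t + 1); positivity) (fun ω h => h.card_mul_req_le hA ht)
    (fun ω h => ?_) ?_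
  · rw [le_div_iff₀ (hk t)]
    exact h t ht le_rfl
  · have h1 := two_exp_mul_pow_le_one hη0 hη (hA.one_le_req t)
    have h2 := hA.succ_le t ht
    have hkt := hk t
    rw [le_div_iff₀ (hk (t + 1))]
    calc 2 * Real.exp 1 * (η * n / k t) * η ^ A.req t * k (t + 1)
        ≤ 2 * Real.exp 1 * (η * n / k t) * η ^ A.req t * (k t * Real.exp ((A.req t : ℝ) / 5)) := by
          gcongr
      _ = 2 * Real.exp 1 * (η ^ A.req t * Real.exp ((A.req t : ℝ) / 5)) * (η * n) := by
          field_simp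
      _ ≤ 1 * (η * n) := by gcongr
      _ = η * n := one_mul _

theorem prob_not_fewRequests_le {A : Schedule} {k : ℕ → ℝ} (hA : Growing A k)
    (rule : ChoiceRule n) {η M δ : ℝ} (hη0 : 0 ≤ η) (hη : η ≤ 1 / 8) (hM : ∀ t, k t ≤ M)
    (hδ : (coinMeasure n).real {ω | ¬ FewRequests A rule k η 1 ω} ≤ δ) (t : ℕ) :
    (coinMeasure n).real {ω | ¬ FewRequests A rule k η (t + 1) ω} ≤
      δ + t * (1 / 2 : ℝ) ^ (η * n / M) := by
  induction t with
  | zero => simpa using hδ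
  | succ t ih =>
    have h1 := prob_fewRequests_fails_in_round_le hA rule hη0 hη (t := t + 1) (by omega)
    have h2 : (1 / 2 : ℝ) ^ (η * n / k (t + 1 + 1)) ≤ (1 / 2 : ℝ) ^ (η * n / M) := by
      refine Real.rpow_le_rpow_of_exponent_ge (by norm_num) (by norm_num) ?_
      have := hA.pos (t + 1 + 1)
      have := hM (t + 1 + 1)
      gcongr
    refine (measureReal_mono (s₂ := {ω | ¬ FewRequests A rule k η (t + 1) ω} ∪
      {ω | FewRequests A rule k η (t + 1) ω ∧
        η * n / k (t + 1 + 1) < (activeBalls (run A rule ω (t + 1 + 1))).card})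
        (fun ω hω => ?_) (measure_ne_top _ _)).trans
        ((measureReal_union_le _ _).trans ((add_le_add ih (h1.trans h2)).trans_eq
          (by push_cast; ring)))
    by_cases h : FewRequests A rule k η (t + 1) ω
    · right
      refine ⟨h, ?_⟩
      by_contra hcon
      refine hω fun j hj hjt => ?_
      rcases hjt.lt_or_eq with hlt | rfl
      · exact h j hj (by omega)
      · rwa [not_lt, le_div_iff₀ (hA.pos _)] at hcon
    · exact Or.inl h

/-- A round multiplies the survival probability by at most `η ^ m` and `k` by at most `e ^ (m / 5)`,
and the product of these factors is at most 1/2. The geometric decay keeps the expected number of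
requests of a ball bounded independently of `r`. -/
theorem mul_prob_mem_active_le {A : Schedule} {k : ℕ → ℝ} (hA : Growing A k)
    (rule : ChoiceRule n) {η : ℝ} (hη0 : 0 ≤ η) (hη : η ≤ 1 / 8) (b : Fin n) (t : ℕ) :
    k (t + 1) * (coinMeasure n).real
      {ω | FewRequests A rule k η (t + 1) ω ∧ b ∈ activeBalls (run A rule ω (t + 1))} ≤
      (1 / 2) ^ t * (k 1 * (coinMeasure n).real {ω | b ∈ activeBalls (run A rule ω 1)}) := by
  induction t with
  | zero =>
    have := hA.pos 1
    rw [pow_zero, one_mul]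
    exact mul_le_mul_of_nonneg_left (measureReal_mono fun ω h => h.2) this.le
  | succ t ih =>
    have h1 := prob_and_mem_active_succ_le A rule (hA.cap (t + 1))
      (dependsOn_fewRequests A rule k η (t + 1)) hη0
      (fun ω h => h.card_mul_req_le hA (by omega)) b
    have hsub : {ω | FewRequests A rule k η (t + 1 + 1) ω ∧
        b ∈ activeBalls (run A rule ω (t + 1 + 1))} ⊆ {ω | FewRequests A rule k η (t + 1) ω ∧
        b ∈ activeBalls (run A rule ω (t + 1 + 1))} :=
      fun ω hω => ⟨hω.1.mono (Nat.le_succ _), hω.2⟩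
    have h2 := (measureReal_mono hsub (measure_ne_top (coinMeasure n) _)).trans h1
    have h3 := two_exp_mul_pow_le_one hη0 hη (hA.one_le_req (t + 1))
    have h4 := hA.succ_le (t + 1) (by omega)
    have h5 : η ^ A.req (t + 1) * Real.exp ((A.req (t + 1) : ℝ) / 5) ≤ 1 / 2 := by
      have := Real.add_one_le_exp 1
      have h6 : 0 ≤ η ^ A.req (t + 1) * Real.exp ((A.req (t + 1) : ℝ) / 5) := by positivity
      nlinarith
    set p := (coinMeasure n).real
      {ω | FewRequests A rule k η (t + 1) ω ∧ b ∈ activeBalls (run A rule ω (t + 1))}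
    have hp : 0 ≤ p := measureReal_nonneg
    have hk1 := hA.pos (t + 1)
    calc k (t + 1 + 1) * _
        ≤ (k (t + 1) * Real.exp ((A.req (t + 1) : ℝ) / 5)) * (η ^ A.req (t + 1) * p) := by
          gcongr
      _ = (η ^ A.req (t + 1) * Real.exp ((A.req (t + 1) : ℝ) / 5)) * (k (t + 1) * p) := by ring
      _ ≤ 1 / 2 * ((1 / 2) ^ t *
          (k 1 * (coinMeasure n).real {ω | b ∈ activeBalls (run A rule ω 1)})) := by gcongr
      _ = _ := by ring

/-- Once the number `m` of requests per ball stays fixed and few balls are left, it takes a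
constant number of rounds to terminate. -/
theorem prob_not_terminatedBy_le (A : Schedule) (rule : ChoiceRule n) (hcap : ∀ t, 1 ≤ A.cap t)
    {T m : ℕ} (hm : ∀ t, T ≤ t → A.req t = m) {a : ℝ} (ha : 0 ≤ a) (j : ℕ) :
    (coinMeasure n).real {ω | ((activeBalls (run A rule ω T)).card : ℝ) ≤ a ∧
      ¬ TerminatedBy A rule ω (T + j)} ≤ n * ((a * m / n) ^ m) ^ j := by
  have hn : (0 : ℝ) < n := Nat.cast_pos.2 (NeZero.pos n)
  have h1 : ∀ b j, (coinMeasure n).real {ω | ((activeBalls (run A rule ω T)).card : ℝ) ≤ a ∧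
      b ∈ activeBalls (run A rule ω (T + j))} ≤ ((a * m / n) ^ m) ^ j := by
    intro b j
    induction j with
    | zero => simp
    | succ j ih =>
      have h2 := prob_and_mem_active_succ_le A rule (hcap (T + j))
        (P := fun ω => ((activeBalls (run A rule ω T)).card : ℝ) ≤ a)
        (fun ω ω' h => by
          have : run A rule ω T = run A rule ω' T := dependsOn_run_le A rule (T.le_add_right j) h
          simp only [this]) (κ := a * m / n) (by positivity) (fun ω hω => by
            rw [hm _ (T.le_add_right j), div_mul_cancel₀ _ hn.ne']
            gcongr
            refine le_trans ?_ hω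
            exact_mod_cast card_activeBalls_run_antitone A rule ω (T.le_add_right j)) b
      rw [hm _ (T.le_add_right j)] at h2
      refine h2.trans ?_
      rw [pow_succ']
      gcongr
  refine (measureReal_mono (s₂ := ⋃ b ∈ (Finset.univ : Finset (Fin n)),
    {ω | ((activeBalls (run A rule ω T)).card : ℝ) ≤ a ∧
      b ∈ activeBalls (run A rule ω (T + j))}) (fun ω hω => ?_) (measure_ne_top _ _)).trans
    ((measureReal_biUnion_finset_le _ _).trans
      ((Finset.sum_le_card_nsmul _ _ _ fun b _ => h1 b j).trans_eq (by simp)))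
  have h3 := hω.2
  rw [terminatedBy_iff, ← Ne, ← Finset.nonempty_iff_ne_empty] at h3
  obtain ⟨b, hb⟩ := h3
  simp only [Set.mem_iUnion]
  exact ⟨b, Finset.mem_univ b, hω.1, hb⟩

/-! ### Requests received by a bin -/

-- Given the past, at most `κ n` fresh coins are thrown, each showing `v` with probability `1 / n`.
-- They contribute a factor of at most `(1 + y / n) ^ (κ n) ≤ e ^ (y κ)`.
open Classical in
theorem lintegral_pow_binRequests_succ_le (A : Schedule) (rule : ChoiceRule n) {t : ℕ}
    {P : Coins n → Prop} (hP : DependsOn P (coinsBefore n A t : Set (ℕ × Fin n × ℕ))) {κ y : ℝ}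
    (hy : 0 ≤ y)
    (h : ∀ ω, P ω → ((activeBalls (run A rule ω t)).card * A.req t : ℝ) ≤ κ * n) (v : Fin n) :
    ∫⁻ ω, (if P ω then (1 + ENNReal.ofReal y) ^ binRequests A rule ω (t + 1) v else 0)
      ∂coinMeasure n ≤ ENNReal.ofReal (Real.exp (y * κ)) *
      ∫⁻ ω, (if P ω then (1 + ENNReal.ofReal y) ^ binRequests A rule ω t v else 0)
        ∂coinMeasure n := by
  have hn : (0 : ℝ) < n := Nat.cast_pos.2 (NeZero.pos n)
  let φ : Coins n → Requests n → ENNReal := fun ω q =>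
    if P ω then (1 + ENNReal.ofReal y) ^ (binRequests A rule ω t v + ∑ b, (q b).count v) else 0
  have hφ : ∀ q, DependsOn (fun ω => φ ω q) (coinsBefore n A t : Set (ℕ × Fin n × ℕ)) := by
    intro q ω ω' hω
    have h1 := hP hω
    have h2 : binRequests A rule ω t v = binRequests A rule ω' t v :=
      dependsOn_binRequests A rule t v hω
    simp only [φ, h1, h2]
  rw [← lintegral_const_mul' _ _ ENNReal.ofReal_ne_top]
  simp only [binRequests_succ]
  refine (lintegral_requestsAt A rule t hφ).trans_le (lintegral_mono fun ω => ?_)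
  by_cases hω : P ω
  · simp only [φ, hω, if_true, pow_add]
    rw [lintegral_const_mul' _ _ (by finiteness), lintegral_pow_sum_count, mul_comm]
    gcongr
    have h3 : 1 + ENNReal.ofReal y / n = ENNReal.ofReal (1 + y / n) := by
      rw [ENNReal.ofReal_add one_pos.le (by positivity), ENNReal.ofReal_div_of_pos hn]
      simp
    rw [h3, ← ENNReal.ofReal_pow (by positivity)]
    refine ENNReal.ofReal_le_ofReal ?_
    calc (1 + y / n) ^ ((activeBalls (run A rule ω t)).card * A.req t)
        ≤ Real.exp (y / n) ^ ((activeBalls (run A rule ω t)).card * A.req t) := by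
          gcongr
          linarith [Real.add_one_le_exp (y / n)]
      _ = Real.exp (y * (((activeBalls (run A rule ω t)).card * A.req t : ℝ) / n)) := by
          rw [← Real.exp_nat_mul]; congr 1; push_cast; ring
      _ ≤ Real.exp (y * κ) := by
          gcongr
          rw [div_le_iff₀ hn]
          exact h ω hω
  · simp [φ, hω]

-- The first round, with its `n` requests, contributes the 1 in the exponent; each of the `t` later
-- rounds contributes `η`.
open Classical in
theorem lintegral_pow_binRequests_le {A : Schedule} {k : ℕ → ℝ} (hA : Growing A k)
    (rule : ChoiceRule n) (η : ℝ) {y : ℝ} (hy : 0 ≤ y) (v : Fin n) (t : ℕ) :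
    ∫⁻ ω, (if FewRequests A rule k η t ω then
        (1 + ENNReal.ofReal y) ^ binRequests A rule ω (t + 1) v else 0)
      ∂coinMeasure n ≤ ENNReal.ofReal (Real.exp (y * (1 + η * t))) := by
  induction t with
  | zero =>
    refine (lintegral_pow_binRequests_succ_le A rule (dependsOn_fewRequests A rule k η 0)
      (κ := 1) hy (fun ω _ => ?_) v).trans ?_
    · simp [activeBalls_run_zero, hA.req_zero]
    · have : ∀ ω, FewRequests A rule k η 0 ω := fun ω j h1 h2 => by omega
      simp [binRequests, this]
  | succ t ih =>
    refine (lintegral_pow_binRequests_succ_le A rule (dependsOn_fewRequests A rule k η (t + 1))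
      (κ := η) hy (fun ω h => h.card_mul_req_le hA (by omega)) v).trans ?_
    have h1 : ∫⁻ ω, (if FewRequests A rule k η (t + 1) ω then
        (1 + ENNReal.ofReal y) ^ binRequests A rule ω (t + 1) v else 0) ∂coinMeasure n ≤ _ :=
      (lintegral_mono fun ω => by
        by_cases h : FewRequests A rule k η (t + 1) ω
        · simp [h, h.mono t.le_succ]
        · simp [h]).trans ih
    refine (mul_le_mul_right h1 _).trans_eq ?_
    rw [← ENNReal.ofReal_mul (Real.exp_pos _).le, ← Real.exp_add]
    congr 2
    push_cast; ring

open Classical in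
theorem lintegral_count_requestsAt (A : Schedule) (rule : ChoiceRule n) {t : ℕ}
    {P : Coins n → Prop} (hP : DependsOn P (coinsBefore n A t : Set (ℕ × Fin n × ℕ)))
    (v : Fin n) :
    ∫⁻ ω, (if P ω then ((∑ b, (requestsAt A rule ω t b).count v : ℕ) : ENNReal) else 0)
      ∂coinMeasure n =
      A.req t / n * ∑ b, coinMeasure n {ω | P ω ∧ b ∈ activeBalls (run A rule ω t)} := by
  let φ : Coins n → Requests n → ENNReal := fun ω q =>
    if P ω then ((∑ b, (q b).count v : ℕ) : ENNReal) else 0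
  have hφ : ∀ q, DependsOn (fun ω => φ ω q) (coinsBefore n A t : Set (ℕ × Fin n × ℕ)) :=
    fun q => dependsOn_comp hP fun p => if p then ((∑ b, (q b).count v : ℕ) : ENNReal) else 0
  rw [lintegral_requestsAt A rule t hφ]
  have h1 : ∀ ω, ∫⁻ x, φ ω (roundRequests (A.req t) (fun b j => x (t, b, j)) (run A rule ω t))
      ∂coinMeasure n = A.req t / n *
        ∑ b, if P ω ∧ b ∈ activeBalls (run A rule ω t) then (1 : ENNReal) else 0 := by
    intro ω
    by_cases hω : P ω
    · simp only [φ, hω, if_true, true_and, lintegral_sum_count]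
      simp only [Finset.sum_boole, Finset.filter_mem_eq_inter, Finset.univ_inter]
      push_cast
      simp only [div_eq_mul_inv]
      ring
    · simp [φ, hω]
  have hdep := fun b => dependsOn_and_mem_active A rule hP b
  simp_rw [h1]
  rw [lintegral_const_mul', lintegral_finsetSum]
  · simp_rw [lintegral_ite_eq_measure (hdep _)]
  · exact fun b _ => measurable_of_dependsOn (S := coinsBefore n A t) fun ω ω' h => by
      have := hdep b h
      simp only [this]
  · exact ENNReal.div_ne_top (by simp) (by simpa using NeZero.ne n)

end Chaining

/-! ### Total failure probability and expected message counts -/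

section Combination

variable {n : ℕ} [NeZero n]

-- Markov's inequality for `(1 + y) ^ requests`. The condition `η t ≤ 1` makes all later rounds
-- together cost no more than the first one, whence `e ^ (2 y)` independently of the number of
-- rounds.
open Classical in
theorem prob_fewRequests_and_binRequests_gt_le {A : Schedule} {k : ℕ → ℝ} (hA : Growing A k)
    (rule : ChoiceRule n) {η y : ℝ} (hy : 0 ≤ y) (s : ℝ) (v : Fin n) {t : ℕ}
    (hη : η * t ≤ 1) :
    (coinMeasure n).real {ω | FewRequests A rule k η t ω ∧
      s < binRequests A rule ω (t + 1) v} ≤ Real.exp (2 * y) * (1 + y) ^ (-s) := by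
  have h1 := lintegral_pow_binRequests_le hA rule η hy v t
  have hz : (0 : ℝ) < 1 + y := by linarith
  have h2 := mul_meas_ge_le_lintegral₀ (μ := coinMeasure n)
    (f := fun ω => if FewRequests A rule k η t ω then
        (1 + ENNReal.ofReal y) ^ binRequests A rule ω (t + 1) v else 0)
    (measurable_of_dependsOn (S := coinsBefore n A (t + 1)) fun ω ω' h => by
      have h1 := (dependsOn_fewRequests A rule k η t).mono (coinsBefore_mono_set A t.le_succ) h
      have h2 : binRequests A rule ω (t + 1) v = binRequests A rule ω' (t + 1) v :=
        dependsOn_binRequests A rule (t + 1) v h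
      simp only [h1, h2]).aemeasurable (ENNReal.ofReal ((1 + y) ^ s))
  have h3 : ENNReal.ofReal ((1 + y) ^ s) * coinMeasure n {ω | FewRequests A rule k η t ω ∧
      s < binRequests A rule ω (t + 1) v} ≤ ENNReal.ofReal (Real.exp (y * (1 + η * t))) := by
    refine le_trans ?_ (h2.trans h1)
    gcongr
    rintro ⟨hω, hs⟩
    simp only [hω, if_true]
    rw [← ENNReal.ofReal_one, ← ENNReal.ofReal_add one_pos.le hy,
      ← ENNReal.ofReal_pow hz.le]
    refine ENNReal.ofReal_le_ofReal ?_
    rw [← Real.rpow_natCast]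
    exact Real.rpow_le_rpow_of_exponent_le (by linarith) hs.le
  have h4 := ENNReal.toReal_mono ENNReal.ofReal_ne_top h3
  rw [ENNReal.toReal_mul, ENNReal.toReal_ofReal (by positivity),
    ENNReal.toReal_ofReal (by positivity)] at h4
  have h5 : Real.exp (y * (1 + η * t)) ≤ Real.exp (2 * y) := by
    rw [Real.exp_le_exp]
    nlinarith
  rw [Real.rpow_neg hz.le, ← div_eq_mul_inv, le_div_iff₀ (by positivity), mul_comm]
  exact h4.trans h5

/-- The four error terms are: the invariant fails by round `r`; round `r` leaves more than `θ`
balls; some of at most `θ` balls survive `j` further rounds; some bin receives too many requests. -/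
theorem prob_bad_le {A : Schedule} {k : ℕ → ℝ} (hA : Growing A k) (rule : ChoiceRule n)
    {η : ℝ} {r : ℕ} (hr : 1 ≤ r) (hconst : ∀ t, r ≤ t → k t = k r)
    (j : ℕ) (hηj : η * (r + j : ℕ) ≤ 1) {θ : ℝ} (hθ : 0 ≤ θ)
    (h : 2 * Real.exp 1 * (η * n / k r) * η ^ A.req r ≤ θ) {y : ℝ} (hy : 0 ≤ y) (s : ℝ) :
    (coinMeasure n).real {ω | ¬ (FewRequests A rule k η r ω ∧ TerminatedBy A rule ω (r + 1 + j) ∧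
      ∀ v, (binRequests A rule ω (r + 1 + j) v : ℝ) ≤ s)} ≤
      (coinMeasure n).real {ω | ¬ FewRequests A rule k η r ω} + (1 / 2 : ℝ) ^ θ +
      n * ((θ * A.req r / n) ^ A.req r) ^ j + n * (Real.exp (2 * y) * (1 + y) ^ (-s)) := by
  have h1 := prob_and_card_active_gt_le A rule (hA.cap r) (dependsOn_fewRequests A rule k η r)
    (κ := η) (a := η * n / k r) hθ (fun ω h => h.card_mul_req_le hA hr)
    (fun ω h => by rw [le_div_iff₀ (hA.pos r)]; exact h r hr le_rfl) h
  have h2 := prob_not_terminatedBy_le A rule hA.cap (T := r + 1) (m := A.req r)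
    (fun t ht => by rw [hA.req, hA.req, hconst t (by omega)]) hθ j
  have hsum : (coinMeasure n).real (⋃ v ∈ (Finset.univ : Finset (Fin n)),
      {ω | FewRequests A rule k η (r + j) ω ∧ s < binRequests A rule ω (r + j + 1) v}) ≤
      n * (Real.exp (2 * y) * (1 + y) ^ (-s)) :=
    (measureReal_biUnion_finset_le _ _).trans
      ((Finset.sum_le_card_nsmul _ _ _ fun v _ =>
        prob_fewRequests_and_binRequests_gt_le hA rule hy s v hηj).trans_eq (by simp))
  refine (measureReal_mono (fun ω hω => ?_) (measure_ne_top _ _)).trans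
    ((measureReal_union_le _ _).trans (add_le_add ((measureReal_union_le _ _).trans
      (add_le_add ((measureReal_union_le _ _).trans (add_le_add le_rfl h1)) h2)) hsum))
  by_cases hF : FewRequests A rule k η r ω
  · by_cases hT : TerminatedBy A rule ω (r + 1 + j)
    · right
      have hbin : ¬ ∀ v, (binRequests A rule ω (r + 1 + j) v : ℝ) ≤ s := fun hb => hω ⟨hF, hT, hb⟩
      push Not at hbin
      obtain ⟨v, hv⟩ := hbin
      simp only [Set.mem_iUnion]
      refine ⟨v, Finset.mem_univ v,
        hF.of_eventually_const hr (fun t => (hA.pos t).le) hconst _, ?_⟩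
      rwa [show r + j + 1 = r + 1 + j by ring]
    · left
      by_cases hc : θ < (activeBalls (run A rule ω (r + 1))).card
      · exact Or.inl (Or.inr ⟨hF, hc⟩)
      · exact Or.inr ⟨not_lt.1 hc, hT⟩
  · exact Or.inl (Or.inl (Or.inl hF))

-- The first round sends `n` requests, and the next `T` rounds send at most `η n` each, which is at
-- most `n` in total.
omit [NeZero n] in
theorem sum_totalRequests_le {A : Schedule} {k : ℕ → ℝ} (hA : Growing A k) {rule : ChoiceRule n}
    {η : ℝ} {T : ℕ} (hηT : η * T ≤ 1) {ω : Coins n} (hF : FewRequests A rule k η T ω)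
    (hT : TerminatedBy A rule ω (T + 1)) (t : ℕ) :
    ∑ j ∈ Finset.range t, totalRequests A rule ω j ≤ 2 * n := by
  refine (sum_range_le_of_eq_zero (fun j hj => ?_) t (T := T + 1)).trans ?_
  · rw [totalRequests_eq, terminatedBy_iff.1 (hT.mono hj)]; simp
  · rw [Finset.sum_range_succ', totalRequests_eq, activeBalls_run_zero, hA.req_zero]
    have h1 : ((∑ j ∈ Finset.range T, totalRequests A rule ω (j + 1) : ℕ) : ℝ) ≤ n := by
      push_cast
      refine (Finset.sum_le_card_nsmul _ _ (η * n) fun j hj => ?_).trans ?_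
      · rw [totalRequests_eq]
        push_cast
        exact (hF.mono (Finset.mem_range.1 hj)).card_mul_req_le hA (by omega)
      · rw [Finset.card_range, nsmul_eq_mul]
        have : (0 : ℝ) ≤ n := Nat.cast_nonneg n
        nlinarith
    have h2 : ∑ j ∈ Finset.range T, totalRequests A rule ω (j + 1) ≤ n := by exact_mod_cast h1
    simp only [Finset.card_univ, Fintype.card_fin]
    omega

omit [NeZero n] in
theorem totalRequests_le_of_fewRequests {A : Schedule} {k : ℕ → ℝ} (hA : Growing A k)
    {rule : ChoiceRule n} {η : ℝ} (hη : η ≤ 1) {ω : Coins n}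
    (hF : ∀ t, FewRequests A rule k η t ω) (t : ℕ) : totalRequests A rule ω t ≤ n := by
  rw [totalRequests_eq]
  rcases Nat.eq_zero_or_pos t with rfl | ht
  · rw [activeBalls_run_zero, hA.req_zero]; simp
  · have h := (hF t).card_mul_req_le hA ht
    have hn : (0 : ℝ) ≤ n := Nat.cast_nonneg n
    have h2 : (((activeBalls (run A rule ω t)).card * A.req t : ℕ) : ℝ) ≤ n := by
      push_cast; nlinarith
    exact_mod_cast h2

/-! ### Expected numbers of messages -/

theorem sum_req_mul_prob_le {A : Schedule} {k : ℕ → ℝ} (hA : Growing A k) (rule : ChoiceRule n)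
    {η : ℝ} (hη0 : 0 ≤ η) (hη : η ≤ 1 / 8) (b : Fin n)
    (h1 : k 1 * (coinMeasure n).real {ω | b ∈ activeBalls (run A rule ω 1)} ≤ 1) (t : ℕ) :
    ∑ j ∈ Finset.range t, (A.req j : ENNReal) * coinMeasure n
      {ω | FewRequests A rule k η j ω ∧ b ∈ activeBalls (run A rule ω j)} ≤ 3 := by
  have h2 : ∀ j, (A.req (j + 1) : ENNReal) * coinMeasure n
      {ω | FewRequests A rule k η (j + 1) ω ∧ b ∈ activeBalls (run A rule ω (j + 1))} ≤
      ENNReal.ofReal ((1 / 2) ^ j) := by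
    intro j
    have h3 := mul_prob_mem_active_le hA rule hη0 hη b j
    rw [← ofReal_measureReal, ← ENNReal.ofReal_natCast, ← ENNReal.ofReal_mul (Nat.cast_nonneg _)]
    refine ENNReal.ofReal_le_ofReal ?_
    refine (mul_le_mul_of_nonneg_right (hA.req_le _) measureReal_nonneg).trans (h3.trans ?_)
    exact mul_le_of_le_one_right (by positivity) h1
  rcases t with _ | t
  · simp
  rw [Finset.sum_range_succ', hA.req_zero]
  have h4 : ∑ j ∈ Finset.range t, (A.req (j + 1) : ENNReal) * coinMeasure n
      {ω | FewRequests A rule k η (j + 1) ω ∧ b ∈ activeBalls (run A rule ω (j + 1))} ≤ 2 := by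
    refine (Finset.sum_le_sum fun j _ => h2 j).trans ?_
    rw [← ENNReal.ofReal_sum_of_nonneg fun j _ => by positivity]
    refine ENNReal.ofReal_le_of_le_toReal ?_
    simp only [ENNReal.toReal_ofNat]
    exact sum_geometric_two_le t
  -- 2 bounds the geometric series of the later rounds; the other summand is the single request of
  -- the first round.
  calc _ ≤ (2 : ENNReal) + (1 : ℕ) * 1 := by
        gcongr
        exact prob_le_one
    _ = 3 := by norm_num

variable {A : Schedule} {k : ℕ → ℝ} {η : ℝ} {r : ℕ}

omit [NeZero n] in
-- Where the invariant fails, the crude bound of `n` rounds with at most `n` requests each is used;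
-- its weight `n ^ 2` is later cancelled by the small probability of this event.
open Classical in
theorem ballRequests_le_add (hA : Growing A k) (rule : ChoiceRule n) (hr : 1 ≤ r)
    (hconst : ∀ t, r ≤ t → k t = k r) (hreq : ∀ t, A.req t ≤ n) (ω : Coins n) (b : Fin n) :
    (ballRequests A rule ω n b : ENNReal) ≤
      ∑ j ∈ Finset.range n, (A.req j : ENNReal) * (if FewRequests A rule k η j ω ∧
        b ∈ activeBalls (run A rule ω j) then 1 else 0) +
      (n : ENNReal) ^ 2 * (if ¬ FewRequests A rule k η r ω then 1 else 0) := by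
  by_cases hF : FewRequests A rule k η r ω
  · have hF' := hF.of_eventually_const hr (fun t => (hA.pos t).le) hconst
    simp only [hF, hF', true_and, not_true_eq_false, if_false, mul_zero, add_zero]
    rw [ballRequests]
    push_cast
    refine Finset.sum_le_sum fun j _ => ?_
    rw [length_requestsAt]
    split_ifs <;> simp
  · simp only [hF, not_false_eq_true, if_true, mul_one]
    refine le_trans ?_ le_add_self
    have h1 : ballRequests A rule ω n b ≤ n ^ 2 := by
      refine (ballRequests_le_sum_req A rule ω n b).trans
        ((Finset.sum_le_card_nsmul _ _ n fun j _ => hreq j).trans_eq ?_)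
      simp [sq]
    exact_mod_cast h1

omit [NeZero n] in
-- The analogue for bins: on the exceptional event all `n` balls together send at most `n ^ 2`
-- requests per round, hence `n ^ 3` in `n` rounds.
open Classical in
theorem binRequests_le_add (hA : Growing A k) (rule : ChoiceRule n) (hr : 1 ≤ r)
    (hconst : ∀ t, r ≤ t → k t = k r) (hreq : ∀ t, A.req t ≤ n) (ω : Coins n) (v : Fin n) :
    (binRequests A rule ω n v : ENNReal) ≤
      ∑ j ∈ Finset.range n, (if FewRequests A rule k η j ω then
        ((∑ b, (requestsAt A rule ω j b).count v : ℕ) : ENNReal) else 0) +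
      (n : ENNReal) ^ 3 * (if ¬ FewRequests A rule k η r ω then 1 else 0) := by
  by_cases hF : FewRequests A rule k η r ω
  · have hF' := hF.of_eventually_const hr (fun t => (hA.pos t).le) hconst
    simp only [hF, hF', if_true, not_true_eq_false, if_false, mul_zero, add_zero]
    rw [binRequests]
    push_cast
    exact le_rfl
  · simp only [hF, not_false_eq_true, if_true, mul_one]
    refine le_trans ?_ le_add_self
    have h1 : binRequests A rule ω n v ≤ n ^ 3 := by
      refine (binRequests_le_sum_totalRequests A rule ω n v).trans
        ((Finset.sum_le_card_nsmul _ _ (n * n) fun j _ => ?_).trans_eq ?_)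
      · rw [totalRequests_eq]
        refine Nat.mul_le_mul ?_ (hreq j)
        simpa using (activeBalls (run A rule ω j)).card_le_univ
      · simp [pow_succ, mul_assoc]
    exact_mod_cast h1

open Classical in
theorem lintegral_not_fewRequests_le (A : Schedule) (rule : ChoiceRule n) (k : ℕ → ℝ) (η : ℝ)
    (r : ℕ) {i : ℕ}
    (hδ : (n : ℝ) ^ i * (coinMeasure n).real {ω | ¬ FewRequests A rule k η r ω} ≤ 1) :
    ∫⁻ ω, (n : ENNReal) ^ i * (if ¬ FewRequests A rule k η r ω then 1 else 0) ∂coinMeasure n ≤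
      1 := by
  have hdep : DependsOn (fun ω => ¬ FewRequests A rule k η r ω)
    (coinsBefore n A r : Set (ℕ × Fin n × ℕ)) := dependsOn_comp (dependsOn_fewRequests A rule k η r) Not
  rw [lintegral_const_mul' _ _ (by finiteness)]
  have h := lintegral_ite_eq_measure hdep
  refine (mul_le_mul_right (le_of_eq (by convert h)) _).trans ?_
  rw [← ofReal_measureReal, ← ENNReal.ofReal_natCast, ← ENNReal.ofReal_pow (Nat.cast_nonneg _),
    ← ENNReal.ofReal_mul (by positivity)]
  exact ENNReal.ofReal_le_one.2 hδ

theorem lintegral_iSup_ballMessages_le (hA : Growing A k) (rule : ChoiceRule n)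
    (hη0 : 0 ≤ η) (hη : η ≤ 1 / 8) (hr : 1 ≤ r)
    (hconst : ∀ t, r ≤ t → k t = k r) (hreq : ∀ t, A.req t ≤ n)
    (hδ : (n : ℝ) ^ 2 * (coinMeasure n).real {ω | ¬ FewRequests A rule k η r ω} ≤ 1) (b : Fin n)
    (h1 : k 1 * (coinMeasure n).real {ω | b ∈ activeBalls (run A rule ω 1)} ≤ 1) :
    ∫⁻ ω, ⨆ t, (ballMessages A rule ω t b : ENNReal) ∂coinMeasure n ≤ 9 := by
  classical
  have hsup : ∀ ω, ⨆ t, (ballMessages A rule ω t b : ENNReal) ≤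
      2 * (∑ j ∈ Finset.range n, (A.req j : ENNReal) * (if FewRequests A rule k η j ω ∧
        b ∈ activeBalls (run A rule ω j) then 1 else 0) +
      (n : ENNReal) ^ 2 * (if ¬ FewRequests A rule k η r ω then 1 else 0)) + 1 := by
    intro ω
    refine iSup_le fun t => ?_
    have h2 : ballMessages A rule ω t b ≤ 2 * ballRequests A rule ω n b + 1 :=
      (ballMessages_le A rule ω t b).trans (by
        have := ballRequests_le_of_terminatedBy
          (terminatedBy_self rule ω hA.cap hA.one_le_req) t b
        omega)
    have h3 : (ballMessages A rule ω t b : ENNReal) ≤ 2 * (ballRequests A rule ω n b) + 1 := by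
      exact_mod_cast h2
    refine h3.trans ?_
    gcongr
    exact ballRequests_le_add hA rule hr hconst hreq ω b
  refine (lintegral_mono hsup).trans ?_
  have hdep := fun j => dependsOn_and_mem_active A rule (dependsOn_fewRequests A rule k η j) b
  have hm : ∀ j, Measurable fun ω => (if FewRequests A rule k η j ω ∧
        b ∈ activeBalls (run A rule ω j) then (1 : ENNReal) else 0) := fun j =>
    measurable_of_dependsOn (S := coinsBefore n A j) fun ω ω' h => by
      have := hdep j h
      simp only [this]
  have hm1 : Measurable fun ω => ∑ j ∈ Finset.range n, (A.req j : ENNReal) *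
      (if FewRequests A rule k η j ω ∧ b ∈ activeBalls (run A rule ω j) then
        (1 : ENNReal) else 0) :=
    Finset.measurable_fun_sum _ fun j _ => (hm j).const_mul _
  rw [lintegral_add_right _ measurable_const, lintegral_const_mul' _ _ (by finiteness),
    lintegral_add_left hm1, lintegral_finsetSum _ fun j _ => (hm j).const_mul _]
  have h4 := lintegral_not_fewRequests_le A rule k η r hδ
  have h5 := sum_req_mul_prob_le hA rule hη0 hη b h1 n
  have h6 : ∀ j, ∫⁻ ω, (A.req j : ENNReal) * (if FewRequests A rule k η j ω ∧
        b ∈ activeBalls (run A rule ω j) then (1 : ENNReal) else 0) ∂coinMeasure n =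
      A.req j * coinMeasure n
        {ω | FewRequests A rule k η j ω ∧ b ∈ activeBalls (run A rule ω j)} := by
    intro j
    rw [lintegral_const_mul' _ _ (by finiteness), lintegral_ite_eq_measure (hdep j)]
  simp_rw [h6]
  calc _ ≤ (2 : ENNReal) * (3 + 1) + 1 := by
        gcongr
        simp
    _ = 9 := by norm_num

theorem lintegral_iSup_binMessages_le (hA : Growing A k) (rule : ChoiceRule n)
    (hη0 : 0 ≤ η) (hη : η ≤ 1 / 8) (hr : 1 ≤ r)
    (hconst : ∀ t, r ≤ t → k t = k r) (hreq : ∀ t, A.req t ≤ n)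
    (hδ : (n : ℝ) ^ 3 * (coinMeasure n).real {ω | ¬ FewRequests A rule k η r ω} ≤ 1) (v : Fin n)
    (h1 : ∀ b, k 1 * (coinMeasure n).real {ω | b ∈ activeBalls (run A rule ω 1)} ≤ 1) :
    ∫⁻ ω, ⨆ t, (binMessages A rule ω t v : ENNReal) ∂coinMeasure n ≤ 12 := by
  classical
  have hsup : ∀ ω, ⨆ t, (binMessages A rule ω t v : ENNReal) ≤
      3 * (∑ j ∈ Finset.range n, (if FewRequests A rule k η j ω then
        ((∑ b, (requestsAt A rule ω j b).count v : ℕ) : ENNReal) else 0) +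
      (n : ENNReal) ^ 3 * (if ¬ FewRequests A rule k η r ω then 1 else 0)) := by
    intro ω
    refine iSup_le fun t => ?_
    have h2 : binMessages A rule ω t v ≤ 3 * binRequests A rule ω n v :=
      (binMessages_le A rule ω t v).trans (Nat.mul_le_mul_left _
        (binRequests_le_of_terminatedBy (terminatedBy_self rule ω hA.cap hA.one_le_req) t v))
    have h3 : (binMessages A rule ω t v : ENNReal) ≤ 3 * (binRequests A rule ω n v) := by
      exact_mod_cast h2
    refine h3.trans ?_
    gcongr
    exact binRequests_le_add hA rule hr hconst hreq ω v
  refine (lintegral_mono hsup).trans ?_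
  have hm : ∀ j, Measurable fun ω => (if FewRequests A rule k η j ω then
        ((∑ b, (requestsAt A rule ω j b).count v : ℕ) : ENNReal) else 0) := fun j =>
    measurable_of_dependsOn (S := coinsBefore n A (j + 1)) fun ω ω' h => by
      have h2 := (dependsOn_fewRequests A rule k η j).mono (coinsBefore_mono_set A j.le_succ) h
      have h3 : requestsAt A rule ω j = requestsAt A rule ω' j := dependsOn_requestsAt A rule j h
      simp only [h2, h3]
  rw [lintegral_const_mul' _ _ (by finiteness),
    lintegral_add_left (Finset.measurable_fun_sum _ fun j _ => hm j),
    lintegral_finsetSum _ fun j _ => hm j]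
  simp_rw [lintegral_count_requestsAt A rule (dependsOn_fewRequests A rule k η _) v]
  have h4 := lintegral_not_fewRequests_le A rule k η r hδ
  have hn0 : (n : ENNReal) ≠ 0 := by simpa using NeZero.ne n
  have h5 : ∑ j ∈ Finset.range n, (A.req j : ENNReal) / n * ∑ b, coinMeasure n
      {ω | FewRequests A rule k η j ω ∧ b ∈ activeBalls (run A rule ω j)} ≤ 3 := by
    -- Every request hits `v` with probability `1 / n`, so the expected load of requests on `v` is
    -- the average over the balls of their expected requests.
    calc _ = (n : ENNReal)⁻¹ * ∑ b, ∑ j ∈ Finset.range n, (A.req j : ENNReal) * coinMeasure n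
          {ω | FewRequests A rule k η j ω ∧ b ∈ activeBalls (run A rule ω j)} := by
          rw [Finset.sum_comm, Finset.mul_sum]
          refine Finset.sum_congr rfl fun j _ => ?_
          rw [← Finset.mul_sum, div_eq_mul_inv]
          ring
      _ ≤ (n : ENNReal)⁻¹ * ∑ b : Fin n, 3 := by
          gcongr with b
          exact sum_req_mul_prob_le hA rule hη0 hη b (h1 b) n
      _ = 3 := by
          rw [Finset.sum_const, Finset.card_univ, Fintype.card_fin, nsmul_eq_mul, ← mul_assoc,
            ENNReal.inv_mul_cancel hn0 (by simp), one_mul]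
  calc _ ≤ (3 : ENNReal) * (3 + 1) := by gcongr
    _ = 12 := by norm_num

end Combination

/-! ### Growth of `k` and the requirements on `n` -/

section Asymptotics

open Filter Topology

theorem iterLog_succ (i : ℕ) (x : ℝ) : iterLog (i + 1) x = Real.logb 2 (iterLog i x) :=
  Function.iterate_succ_apply' _ _ _

theorem iterLog_one (x : ℝ) : iterLog 1 x = Real.logb 2 x := rfl

theorem tendsto_iterLog (i : ℕ) : Tendsto (fun n : ℕ => iterLog i n) atTop atTop := by
  induction i with
  | zero => exact tendsto_natCast_atTop_atTop
  | succ i ih =>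
    simp only [iterLog_succ]
    exact (Real.tendsto_logb_atTop one_lt_two).comp ih

theorem two_rpow_iterLog_succ {i : ℕ} {x : ℝ} (h : 0 < iterLog i x) :
    (2 : ℝ) ^ iterLog (i + 1) x = iterLog i x := by
  rw [iterLog_succ]
  exact Real.rpow_logb two_pos (by norm_num) h

/-- `log 2 > 1/5 + 49/100`, and `y ≤ e ^ (49 y / 100)`. This drives the upper bound on `k`: one
round undoes at most one binary logarithm. -/
theorem mul_exp_div_five_le {y : ℝ} (hy : 0 ≤ y) : y * Real.exp (y / 5) ≤ (2 : ℝ) ^ y := by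
  have h1 := Real.log_two_gt_d9
  have h2 : y * Real.log 2 ≥ y / 5 + 49 / 100 * y := by nlinarith
  have h3 := Real.quadratic_le_exp_of_nonneg (x := 49 / 100 * y) (by positivity)
  rw [Real.rpow_def_of_pos two_pos, mul_comm (Real.log 2)]
  calc y * Real.exp (y / 5) ≤ Real.exp (49 / 100 * y) * Real.exp (y / 5) := by
        gcongr; nlinarith [sq_nonneg (y - 17 / 8)]
    _ = Real.exp (y / 5 + 49 / 100 * y) := by rw [← Real.exp_add, add_comm]
    _ ≤ Real.exp (y * Real.log 2) := by gcongr

/-- The factor 10 pays for the 1/5 in the exponent, the floor, and the change of base: `⌊z⌋ / 5 ≥ 2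
y - 1/5 ≥ y log 2`. It also reproduces itself, so one round undoes at least one logarithm. -/
theorem ten_mul_two_rpow_le {y z : ℝ} (hy : 1 ≤ y) (hz : 10 * y ≤ z) :
    10 * (2 : ℝ) ^ y ≤ z * Real.exp ((⌊z⌋₊ : ℝ) / 5) := by
  have h1 := Real.log_two_lt_d9
  have h2 := Nat.lt_floor_add_one z
  have h3 : (2 : ℝ) ^ y ≤ Real.exp ((⌊z⌋₊ : ℝ) / 5) := by
    rw [Real.rpow_def_of_pos two_pos, Real.exp_le_exp]
    nlinarith
  calc 10 * (2 : ℝ) ^ y ≤ z * (2 : ℝ) ^ y := by gcongr; linarith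
    _ ≤ z * Real.exp ((⌊z⌋₊ : ℝ) / 5) := by
      gcongr; linarith

/-- `l!`-type growth of the number of places in the first round. -/
theorem eventually_exp_div_floor_pow_le :
    ∀ᶠ L : ℝ in atTop, 1 ≤ ⌊L / Real.logb 2 L⌋₊ ∧
      (Real.exp 1 / ⌊L / Real.logb 2 L⌋₊) ^ ⌊L / Real.logb 2 L⌋₊ ≤ (2 : ℝ) ^ (-(L / 2)) := by
  have hlog : (fun L : ℝ => Real.log L) =o[atTop] fun L => L ^ (1 / 4 : ℝ) :=
    isLittleO_log_rpow_atTop (by norm_num)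
  -- The constant is chosen so that `log₂ L ≤ L^(1/4) / 12`. Then `l ≥ (3/4) L / log₂ L ≥ e
  -- L^(3/4)`, so `(e / l) ^ l ≤ 2 ^ (-(9/16) L)`.
  have h1 := hlog.bound (c := Real.log 2 / 12) (by have := Real.log_pos one_lt_two; positivity)
  filter_upwards [h1, eventually_ge_atTop (16 : ℝ)] with L hL hL16
  have hl2 := Real.log_pos one_lt_two
  have hL0 : 0 < L := by linarith
  have hlogL : 0 < Real.log L := Real.log_pos (by linarith)
  rw [Real.norm_of_nonneg hlogL.le, Real.norm_of_nonneg (by positivity)] at hL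
  have hlb : Real.logb 2 L ≤ L ^ (1 / 4 : ℝ) / 12 := by
    rw [Real.logb, div_le_iff₀ hl2]; linarith
  have hlb4 : 4 ≤ Real.logb 2 L := by
    rw [Real.le_logb_iff_rpow_le one_lt_two hL0]
    norm_num; exact hL16
  have hlb0 : 0 < Real.logb 2 L := by linarith
  set l := ⌊L / Real.logb 2 L⌋₊ with hl
  have hpow1 : (1 : ℝ) ≤ L ^ (1 / 4 : ℝ) := Real.one_le_rpow (by linarith) (by norm_num)
  have hpow : L = L ^ (3 / 4 : ℝ) * L ^ (1 / 4 : ℝ) := by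
    rw [← Real.rpow_add hL0]; norm_num
  have hpow34 : (1 : ℝ) ≤ L ^ (3 / 4 : ℝ) := Real.one_le_rpow (by linarith) (by norm_num)
  have hq : 12 * L ^ (3 / 4 : ℝ) ≤ L / Real.logb 2 L := by
    rw [le_div_iff₀ hlb0]
    calc 12 * L ^ (3 / 4 : ℝ) * Real.logb 2 L
        ≤ 12 * L ^ (3 / 4 : ℝ) * (L ^ (1 / 4 : ℝ) / 12) := by gcongr
      _ = L ^ (3 / 4 : ℝ) * L ^ (1 / 4 : ℝ) := by ring
      _ = L := hpow.symm
  have hlfl := Nat.lt_floor_add_one (L / Real.logb 2 L)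
  rw [← hl] at hlfl
  have hl34 : 3 / 4 * (L / Real.logb 2 L) ≤ l := by linarith
  have hle : Real.exp 1 * L ^ (3 / 4 : ℝ) ≤ l := by
    have := Real.exp_one_lt_d9
    nlinarith
  have hl1 : (1 : ℝ) ≤ l := by
    have := Real.add_one_le_exp 1
    nlinarith
  refine ⟨by exact_mod_cast hl1, ?_⟩
  have hl0 : (0 : ℝ) < l := by linarith
  have hbase : Real.exp 1 / l ≤ (2 : ℝ) ^ (-(3 / 4 * Real.logb 2 L)) := by
    have : (2 : ℝ) ^ (3 / 4 * Real.logb 2 L) = L ^ (3 / 4 : ℝ) := by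
      rw [mul_comm, Real.rpow_mul two_pos.le, Real.rpow_logb two_pos (by norm_num) hL0]
    rw [Real.rpow_neg two_pos.le, this, div_le_iff₀ hl0, ← div_eq_inv_mul,
      le_div_iff₀ (by positivity)]
    exact hle
  calc (Real.exp 1 / l) ^ l ≤ ((2 : ℝ) ^ (-(3 / 4 * Real.logb 2 L))) ^ l := by gcongr
    _ = (2 : ℝ) ^ (-(3 / 4 * Real.logb 2 L) * l) := by
      rw [← Real.rpow_natCast, ← Real.rpow_mul two_pos.le]
    _ ≤ (2 : ℝ) ^ (-(L / 2)) := by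
      refine Real.rpow_le_rpow_of_exponent_le one_le_two ?_
      have h5 : 9 / 16 * L ≤ 3 / 4 * Real.logb 2 L * l := by
        calc 9 / 16 * L = 3 / 4 * Real.logb 2 L * (3 / 4 * (L / Real.logb 2 L)) := by
              field_simp; norm_num
          _ ≤ _ := by gcongr
      linarith

/-- An exponential in `√n` beats every power of `n`. The division by 4 leaves room for the four
error terms of `prob_bad_le`. -/
theorem eventually_mul_half_rpow_sqrt_le (K c : ℝ) {η : ℝ} (hη : 0 < η) :
    ∀ᶠ n : ℕ in atTop, K * (1 / 2 : ℝ) ^ (η * Real.sqrt n) ≤ (n : ℝ) ^ (-c) / 4 := by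
  have hl2 := Real.log_pos one_lt_two
  have h1 := tendsto_rpow_mul_exp_neg_mul_atTop_nhds_zero (2 * c) (η * Real.log 2) (by positivity)
  have h2 : Tendsto (fun n : ℕ => Real.sqrt n) atTop atTop :=
    Real.tendsto_sqrt_atTop.comp tendsto_natCast_atTop_atTop
  have h3 := (h1.comp h2).const_mul (4 * K)
  rw [mul_zero] at h3
  filter_upwards [h3.eventually_le_const one_pos, eventually_gt_atTop 0] with n hn hn0
  have hn0' : (0 : ℝ) < n := by exact_mod_cast hn0
  simp only [Function.comp_apply] at hn
  have h4 : Real.sqrt n ^ (2 * c) = (n : ℝ) ^ c := by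
    rw [Real.sqrt_eq_rpow, ← Real.rpow_mul hn0'.le]; congr 1; ring
  have h5 : (1 / 2 : ℝ) ^ (η * Real.sqrt n) = Real.exp (-(η * Real.log 2) * Real.sqrt n) := by
    rw [Real.rpow_def_of_pos (by norm_num), one_div, Real.log_inv]; congr 1; ring
  rw [h4, ← h5] at hn
  rw [Real.rpow_neg hn0'.le, le_div_iff₀ (by norm_num), ← one_div,
    le_div_iff₀ (Real.rpow_pos_of_pos hn0' c)]
  linarith

/-- The requirements on the size of `n` that do not involve the error probability. -/
structure LargeEnough (n r : ℕ) : Prop where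
  iterLog_ge : ∀ i ≤ r + 1, 16 ≤ iterLog i n
  exp_ge : 10 * iterLog (r - 1) n ≤ Real.exp ((iterLog (r - 1) n ^ (1 / 4 : ℝ) - 1) / 5)
  sqrt_le : Real.sqrt (Real.logb 2 n) ≤ (n : ℝ) ^ (1 / 4 : ℝ)
  one_le_cap : 1 ≤ ⌊iterLog r n / iterLog (r + 1) n⌋₊
  cap_pow_le : (Real.exp 1 / ⌊iterLog r n / iterLog (r + 1) n⌋₊) ^
    ⌊iterLog r n / iterLog (r + 1) n⌋₊ ≤ (iterLog (r - 1) n) ^ (-(1 / 2) : ℝ)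

theorem eventually_ten_mul_le_exp :
    ∀ᶠ x : ℝ in atTop, 10 * x ≤ Real.exp ((x ^ (1 / 4 : ℝ) - 1) / 5) := by
  have h1 := tendsto_rpow_mul_exp_neg_mul_atTop_nhds_zero 4 (1 / 5) (by norm_num)
  have h2 := (h1.comp (tendsto_rpow_atTop (y := 1 / 4) (by norm_num))).const_mul
    (10 * Real.exp (1 / 5))
  rw [mul_zero] at h2
  filter_upwards [h2.eventually_le_const one_pos, eventually_gt_atTop 0] with x hx hx0
  simp only [Function.comp_apply] at hx
  have h3 : (x ^ (1 / 4 : ℝ)) ^ (4 : ℝ) = x := by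
    rw [← Real.rpow_mul hx0.le]; norm_num
  rw [h3] at hx
  have h4 : Real.exp ((x ^ (1 / 4 : ℝ) - 1) / 5) *
      (Real.exp (1 / 5) * Real.exp (-(1 / 5) * x ^ (1 / 4 : ℝ))) = 1 := by
    rw [← Real.exp_add, ← Real.exp_add, Real.exp_eq_one_iff]; ring
  calc 10 * x = Real.exp ((x ^ (1 / 4 : ℝ) - 1) / 5) *
      (10 * Real.exp (1 / 5) * (x * Real.exp (-(1 / 5) * x ^ (1 / 4 : ℝ)))) := by
        linear_combination (-(10 * x)) * h4
    _ ≤ Real.exp ((x ^ (1 / 4 : ℝ) - 1) / 5) * 1 := by gcongr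
    _ = _ := mul_one _

theorem eventually_largeEnough {r : ℕ} (hr : 1 ≤ r) : ∀ᶠ n : ℕ in atTop, LargeEnough n r := by
  have h1 : ∀ᶠ n : ℕ in atTop, ∀ i ∈ Finset.range (r + 2), 16 ≤ iterLog i n :=
    (Finset.eventually_all _).2 fun i _ => (tendsto_iterLog i).eventually_ge_atTop 16
  have h3 : ∀ᶠ n : ℕ in atTop, Real.sqrt (Real.logb 2 n) ≤ (n : ℝ) ^ (1 / 4 : ℝ) := by
    have hlog : (fun x : ℝ => Real.log x) =o[atTop] fun x => x ^ (1 / 2 : ℝ) :=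
      isLittleO_log_rpow_atTop (by norm_num)
    have h := hlog.bound (c := Real.log 2) (Real.log_pos one_lt_two)
    filter_upwards [tendsto_natCast_atTop_atTop.eventually h, eventually_ge_atTop 1] with n hn hn1
    have hn1' : (1 : ℝ) ≤ n := by exact_mod_cast hn1
    rw [Real.norm_of_nonneg (Real.log_nonneg hn1'), Real.norm_of_nonneg (by positivity)] at hn
    refine Real.sqrt_le_iff.2 ⟨by positivity, ?_⟩
    rw [← Real.rpow_natCast, ← Real.rpow_mul (by positivity), Real.logb,
      div_le_iff₀ (Real.log_pos one_lt_two)]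
    norm_num
    linarith
  filter_upwards [h1, (tendsto_iterLog (r - 1)).eventually eventually_ten_mul_le_exp, h3,
    (tendsto_iterLog r).eventually eventually_exp_div_floor_pow_le] with n g1 g2 g3 g4
  have g1' : ∀ i ≤ r + 1, 16 ≤ iterLog i n := fun i hi => g1 i (by simp; omega)
  rw [← iterLog_succ] at g4
  refine ⟨g1', g2, g3, g4.1, g4.2.trans_eq ?_⟩
  -- With `L = log^{(r)} n`, the bound `2 ^ (-L / 2)` becomes the power `-1/2` of `log^{(r-1)} n`.
  obtain ⟨i, rfl⟩ : ∃ i, r = i + 1 := ⟨r - 1, by omega⟩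
  have hpos : 0 < iterLog i n := by have := g1' i (by omega); linarith
  rw [Nat.add_sub_cancel, ← two_rpow_iterLog_succ hpos, ← Real.rpow_mul two_pos.le]
  congr 1; ring

namespace LargeEnough

variable {n r : ℕ}

theorem logb_ge (h : LargeEnough n r) : 16 ≤ Real.logb 2 n := h.iterLog_ge 1 (by omega)

theorem cast_ge (h : LargeEnough n r) : (16 : ℝ) ≤ n := h.iterLog_ge 0 (by omega)

theorem four_le_sqrt (h : LargeEnough n r) : 4 ≤ Real.sqrt (Real.logb 2 n) :=
  Real.le_sqrt_of_sq_le (by have := h.logb_ge; linarith)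

theorem sqrt_sq (h : LargeEnough n r) :
    Real.sqrt (Real.logb 2 n) * Real.sqrt (Real.logb 2 n) = Real.logb 2 n :=
  Real.mul_self_sqrt (by have := h.logb_ge; linarith)

theorem two_rpow_logb (h : LargeEnough n r) : (2 : ℝ) ^ Real.logb 2 n = n :=
  Real.rpow_logb two_pos (by norm_num) (by have := h.cast_ge; linarith)

theorem logb_le (h : LargeEnough n r) : Real.logb 2 n ≤ n := by
  have h1 : Real.logb 2 n < 2 ^ Real.logb 2 n := by
    rw [← Real.logb_lt_iff_lt_rpow one_lt_two (by have := h.logb_ge; linarith)]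
    rw [Real.logb, div_lt_iff₀ (Real.log_pos one_lt_two)]
    have h2 := h.logb_ge
    have h3 := Real.log_two_gt_d9
    have h4 := Real.log_le_sub_one_of_pos (x := Real.sqrt (Real.logb 2 n))
      (by have := h.four_le_sqrt; linarith)
    rw [Real.log_sqrt (by linarith)] at h4
    nlinarith [h.four_le_sqrt, h.sqrt_sq]
  exact (h1.trans_eq h.two_rpow_logb).le

theorem sqrt_logb_le (h : LargeEnough n r) : Real.sqrt (Real.logb 2 n) ≤ Real.sqrt n :=
  Real.sqrt_le_sqrt h.logb_le

theorem cast_div_ge (h : LargeEnough n r) :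
    Real.sqrt n ≤ n / Real.sqrt (Real.logb 2 n) := by
  have h1 := h.four_le_sqrt
  rw [le_div_iff₀ (by linarith)]
  calc Real.sqrt n * Real.sqrt (Real.logb 2 n) ≤ Real.sqrt n * Real.sqrt n := by
        exact mul_le_mul_of_nonneg_left h.sqrt_logb_le (Real.sqrt_nonneg _)
    _ = n := Real.mul_self_sqrt (Nat.cast_nonneg n)

theorem one_le_kSeq (h : LargeEnough n r) (t : ℕ) : 1 ≤ kSeq n r (1 / 4) t := by
  have h4 := h.four_le_sqrt
  induction t using Nat.strong_induction_on with
  | _ t ih =>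
    match t with
    | 0 => exact le_rfl
    | 1 =>
      refine le_min (Real.one_le_rpow ?_ (by norm_num)) (by linarith)
      have := h.iterLog_ge (r - 1) (by omega)
      linarith
    | t + 2 =>
      refine le_min ?_ (by linarith)
      exact one_le_mul_of_one_le_of_one_le (ih (t + 1) (by omega))
        (Real.one_le_exp (by positivity))

theorem kSeq_le_sqrt (h : LargeEnough n r) (t : ℕ) :
    kSeq n r (1 / 4) t ≤ Real.sqrt (Real.logb 2 n) := by
  match t with
  | 0 => exact le_trans (by norm_num [kSeq]) h.four_le_sqrt
  | 1 => exact min_le_right _ _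
  | t + 2 => exact min_le_right _ _

theorem growing (h : LargeEnough n r) : Growing (algAbr n r (1 / 4)) (kSeq n r (1 / 4)) where
  cap t := by
    simp only [algAbr]
    split_ifs
    · exact h.one_le_cap
    · exact le_rfl
  req t := rfl
  zero := rfl
  one_le := h.one_le_kSeq
  succ_le t ht := by
    obtain ⟨i, rfl⟩ : ∃ i, t = i + 1 := ⟨t - 1, by omega⟩
    exact min_le_left _ _

/-- Below the cap, each exponential step removes one logarithm. The first such step starts from `x ^
(1/4)` with `x = log^{(r-1)} n` instead of `10 x`, which `exp_ge` makes up for. -/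
theorem kSeq_ge (h : LargeEnough n r) {j : ℕ} (hj : j + 2 ≤ r) :
    min (10 * iterLog (r - 1 - j) n) (Real.sqrt (Real.logb 2 n)) ≤ kSeq n r (1 / 4) (j + 2) := by
  induction j with
  | zero =>
    refine le_min ?_ (min_le_right _ _)
    rcases min_cases (iterLog (r - 1) n ^ (1 / 4 : ℝ)) (Real.sqrt (Real.logb 2 n)) with hc | hc
    · have h1 : kSeq n r (1 / 4) 1 = iterLog (r - 1) n ^ (1 / 4 : ℝ) := hc.1
      have h2 := h.one_le_kSeq 1
      change _ ≤ kSeq n r (1 / 4) 1 * Real.exp ((⌊kSeq n r (1 / 4) 1⌋₊ : ℝ) / 5)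
      refine (min_le_left _ _).trans (h.exp_ge.trans ?_)
      refine le_trans ?_ (le_mul_of_one_le_left (Real.exp_pos _).le h2)
      have h3 := Nat.lt_floor_add_one (kSeq n r (1 / 4) 1)
      rw [← h1, Real.exp_le_exp]
      linarith
    · have h1 : kSeq n r (1 / 4) 1 = Real.sqrt (Real.logb 2 n) := hc.1
      change _ ≤ kSeq n r (1 / 4) 1 * Real.exp ((⌊kSeq n r (1 / 4) 1⌋₊ : ℝ) / 5)
      rw [h1]
      exact (min_le_right _ _).trans (le_mul_of_one_le_right (Real.sqrt_nonneg _)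
        (Real.one_le_exp (by positivity)))
  | succ j ih =>
    have ih := ih (by omega)
    refine le_min ?_ (min_le_right _ _)
    rw [show j + 1 + 1 = j + 2 from rfl]
    have hi : r - 1 - j = r - 1 - (j + 1) + 1 := by omega
    rcases min_le_iff.1 ih with h1 | h1
    · refine (min_le_left _ _).trans ?_
      have hpos := h.iterLog_ge (r - 1 - (j + 1)) (by omega)
      have hy := h.iterLog_ge (r - 1 - j) (by omega)
      rw [hi] at h1 hy
      have := ten_mul_two_rpow_le (by linarith) h1
      rwa [two_rpow_iterLog_succ (by linarith)] at this
    · refine (min_le_right _ _).trans (h1.trans ?_)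
      exact le_mul_of_one_le_right (by have := h.one_le_kSeq (j + 2); linarith)
        (Real.one_le_exp (by positivity))

/-- For `r ≥ 2`, the lower bound at index `r` is the minimum of `10 log n` and the cap. For `r = 1`
the initial value `n ^ (1/4)` already exceeds the cap. -/
theorem kSeq_eq_sqrt (h : LargeEnough n r) (hr : 1 ≤ r) {t : ℕ} (ht : r ≤ t) :
    kSeq n r (1 / 4) t = Real.sqrt (Real.logb 2 n) := by
  refine Nat.le_induction ?_ (fun t ht ih => ?_) t ht
  · refine le_antisymm (h.kSeq_le_sqrt r) ?_
    rcases hr.eq_or_lt with rfl | hr2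
    · exact le_min h.sqrt_le le_rfl
    · have h1 := h.kSeq_ge (j := r - 2) (by omega)
      rw [show r - 1 - (r - 2) = 1 by omega, show r - 2 + 2 = r by omega, iterLog_one] at h1
      rwa [min_eq_right] at h1
      have h2 := h.four_le_sqrt
      have h3 := h.sqrt_sq
      nlinarith
  · obtain ⟨i, rfl⟩ : ∃ i, t = i + 1 := ⟨t - 1, by omega⟩
    refine min_eq_right ?_
    rw [ih]
    exact le_mul_of_one_le_right (Real.sqrt_nonneg _) (Real.one_le_exp (by positivity))

theorem kSeq_const (h : LargeEnough n r) (hr : 1 ≤ r) (t : ℕ) (ht : r ≤ t) :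
    kSeq n r (1 / 4) t = kSeq n r (1 / 4) r := by
  rw [h.kSeq_eq_sqrt hr ht, h.kSeq_eq_sqrt hr le_rfl]

/-- Starting below `log^{(r-1)} n`, the sequence climbs at most one logarithm per round. So `k`
cannot approach the cap early, which would make the messages per ball depend on `r`. -/
theorem kSeq_le_iterLog (h : LargeEnough n r) {j : ℕ} (hj : j + 1 ≤ r) :
    kSeq n r (1 / 4) (j + 1) ≤ iterLog (r - 1 - j) n := by
  induction j with
  | zero =>
    refine (min_le_left _ _).trans ?_
    have := h.iterLog_ge (r - 1) (by omega)
    exact Real.rpow_le_self_of_one_le (by linarith) (by norm_num)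
  | succ j ih =>
    have ih := ih (by omega)
    have hi : r - 1 - j = r - 1 - (j + 1) + 1 := by omega
    have hpos := h.iterLog_ge (r - 1 - (j + 1)) (by omega)
    have hy := h.iterLog_ge (r - 1 - j) (by omega)
    have h1 := h.one_le_kSeq (j + 1)
    have h2 := Nat.floor_le (a := kSeq n r (1 / 4) (j + 1)) (by linarith)
    have h3 := mul_exp_div_five_le (y := iterLog (r - 1 - j) n) (by linarith)
    have h4 : (2 : ℝ) ^ iterLog (r - 1 - j) n = iterLog (r - 1 - (j + 1)) n := by
      rw [hi, two_rpow_iterLog_succ (by linarith)]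
    rw [h4] at h3
    refine (min_le_left _ _).trans (le_trans ?_ h3)
    gcongr
    linarith

theorem iterLog_antitone (h : LargeEnough n r) {i j : ℕ} (hij : i ≤ j) (hj : j ≤ r) :
    iterLog j n ≤ iterLog i n := by
  induction j, hij using Nat.le_induction with
  | base => exact le_rfl
  | succ j hij ih =>
    refine le_trans ?_ (ih (by omega))
    have h1 := h.iterLog_ge j (by omega)
    have h2 := h.iterLog_ge (j + 1) (by omega)
    have h3 := two_rpow_iterLog_succ (i := j) (x := n) (by linarith)
    have h4 := mul_exp_div_five_le (y := iterLog (j + 1) n) (by linarith)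
    rw [h3] at h4
    refine le_trans (le_mul_of_one_le_right (by linarith) (Real.one_le_exp ?_)) h4
    linarith

/-- Before index `r - 1` the sequence is below `log log n`, so only the last phase can cost `√(log
n)`. -/
theorem kSeq_le_add (h : LargeEnough n r) (t : ℕ) :
    kSeq n r (1 / 4) t ≤ 1 + iterLog 2 n +
      if r ≤ t + 1 then Real.sqrt (Real.logb 2 n) else 0 := by
  have h2 : 0 ≤ iterLog 2 n := by
    rw [iterLog_succ, iterLog_one]
    exact Real.logb_nonneg one_lt_two (by have := h.logb_ge; linarith)
  split_ifs with ht
  · have := h.kSeq_le_sqrt t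
    linarith
  · rcases t with _ | t
    · simp only [kSeq]; linarith
    · have h1 := h.kSeq_le_iterLog (j := t) (by omega)
      have h3 := h.iterLog_antitone (i := 2) (j := r - 1 - t) (by omega) (by omega)
      linarith

/-- Only the `j + 2` indices from `r - 1` to `r + j` can involve `√(log n)`. The part whose
coefficient depends on `r` is of order `log log n` and is absorbed for large `n`. -/
theorem sum_req_le (h : LargeEnough n r) (j : ℕ) :
    ((∑ t ∈ Finset.range (r + 1 + j), (algAbr n r (1 / 4)).req t : ℕ) : ℝ) ≤
      (r + 1 + j) * (1 + iterLog 2 n) + (j + 2) * Real.sqrt (Real.logb 2 n) := by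
  push_cast
  calc _ ≤ ∑ t ∈ Finset.range (r + 1 + j), (1 + iterLog 2 n +
        if r ≤ t + 1 then Real.sqrt (Real.logb 2 n) else 0) :=
        Finset.sum_le_sum fun t _ => (h.growing.req_le t).trans (h.kSeq_le_add t)
    _ = (r + 1 + j) * (1 + iterLog 2 n) +
        ((Finset.range (r + 1 + j)).filter fun t => r ≤ t + 1).card *
          Real.sqrt (Real.logb 2 n) := by
      rw [Finset.sum_add_distrib, Finset.sum_const, Finset.card_range, nsmul_eq_mul,
        ← Finset.sum_filter, Finset.sum_const, nsmul_eq_mul]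
      push_cast; ring
    _ ≤ _ := by
      gcongr
      have : ((Finset.range (r + 1 + j)).filter fun t => r ≤ t + 1).card ≤ j + 2 := by
        calc _ ≤ (Finset.Ico (r - 1) (r + 1 + j)).card := by
              refine Finset.card_le_card fun t ht => ?_
              simp only [Finset.mem_filter, Finset.mem_range, Finset.mem_Ico] at ht ⊢
              omega
          _ ≤ j + 2 := by rw [Nat.card_Ico]; omega
      exact_mod_cast this

theorem req_le_cast (h : LargeEnough n r) (t : ℕ) : (algAbr n r (1 / 4)).req t ≤ n := by
  have h1 := h.growing.req_le t
  have h2 := h.kSeq_le_sqrt t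
  have h3 : (((algAbr n r (1 / 4)).req t : ℕ) : ℝ) ≤ n := by
    nlinarith [h.four_le_sqrt, h.sqrt_sq, h.logb_le]
  exact_mod_cast h3

end LargeEnough

end Asymptotics

/-! ### Choice of parameters -/

section Main

open Filter Topology

theorem eventually_mul_one_add_logb_le (K : ℝ) :
    ∀ᶠ y : ℝ in atTop, K * (1 + Real.logb 2 y) ≤ Real.sqrt y := by
  have hl2 := Real.log_pos one_lt_two
  have hlog : (fun y : ℝ => Real.log y) =o[atTop] fun y => y ^ (1 / 2 : ℝ) :=
    isLittleO_log_rpow_atTop (by norm_num)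
  have hK : 0 < 2 * (|K| + 1) := by positivity
  have h1 := hlog.bound (c := Real.log 2 / (2 * (|K| + 1))) (by positivity)
  have h2 := Real.tendsto_sqrt_atTop.eventually_ge_atTop (2 * |K|)
  filter_upwards [h1, h2, eventually_ge_atTop 1] with y hy1 hy2 hy
  rw [Real.norm_of_nonneg (Real.log_nonneg hy), Real.norm_of_nonneg (by positivity),
    ← Real.sqrt_eq_rpow, div_mul_eq_mul_div, le_div_iff₀ hK] at hy1
  have h3 : Real.logb 2 y * (2 * (|K| + 1)) ≤ Real.sqrt y := by
    rw [Real.logb, div_mul_eq_mul_div, div_le_iff₀ hl2]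
    linarith
  have h4 : 0 ≤ Real.logb 2 y := Real.logb_nonneg one_lt_two hy
  calc K * (1 + Real.logb 2 y) ≤ |K| * (1 + Real.logb 2 y) := by
        gcongr; exact le_abs_self K
    _ ≤ Real.sqrt y := by nlinarith

namespace LargeEnough

variable {n r : ℕ} [NeZero n]

-- With `x = log^{(r-1)} n`, the heavy fraction of order `x^(-1/2)` times `k 1 ≤ x^(1/4)` leaves a
-- spare factor `x^(-1/4)`, which beats any constant over `η`. This is the purpose of `γ = 1/4`. The
-- 6 anticipates the loss `2 e < 6` in passing from heavy bins to surviving balls.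
omit [NeZero n] in
theorem first_round_condition (h : LargeEnough n r) {η : ℝ}
    (hx : 12 * Real.exp 1 ≤ η * iterLog (r - 1) n ^ (1 / 4 : ℝ)) :
    2 * Real.exp 1 * n * (Real.exp 1 / ⌊iterLog r n / iterLog (r + 1) n⌋₊) ^
      ⌊iterLog r n / iterLog (r + 1) n⌋₊ ≤ η * n / (6 * kSeq n r (1 / 4) 1) := by
  set x := iterLog (r - 1) n with hxdef
  have hx0 : 0 < x := by have := h.iterLog_ge (r - 1) (by omega); linarith
  have hk1 := h.growing.pos 1
  have hkx : kSeq n r (1 / 4) 1 ≤ x ^ (1 / 4 : ℝ) := min_le_left _ _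
  rw [le_div_iff₀ (by positivity)]
  have h1 : x ^ (1 / 4 : ℝ) * (x ^ (1 / 4 : ℝ) * x ^ (-(1 / 2) : ℝ)) = 1 := by
    rw [← Real.rpow_add hx0, ← Real.rpow_add hx0]; norm_num
  have hpos : 0 < x ^ (-(1 / 2) : ℝ) := by positivity
  calc _ ≤ 2 * Real.exp 1 * n * x ^ (-(1 / 2) : ℝ) * (6 * x ^ (1 / 4 : ℝ)) := by
        gcongr; exact h.cap_pow_le
    _ = n * (12 * Real.exp 1) * (x ^ (1 / 4 : ℝ) * x ^ (-(1 / 2) : ℝ)) := by ring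
    _ ≤ n * (η * x ^ (1 / 4 : ℝ)) * (x ^ (1 / 4 : ℝ) * x ^ (-(1 / 2) : ℝ)) := by gcongr
    _ = n * η * (x ^ (1 / 4 : ℝ) * (x ^ (1 / 4 : ℝ) * x ^ (-(1 / 2) : ℝ))) := by ring
    _ = η * n := by rw [h1]; ring

omit [NeZero n] in
theorem half_rpow_le (h : LargeEnough n r) {η : ℝ} (hη0 : 0 ≤ η) {k : ℝ} (hk : 0 < k)
    (hkS : k ≤ Real.sqrt (Real.logb 2 n)) :
    (1 / 2 : ℝ) ^ (η * n / k) ≤ (1 / 2 : ℝ) ^ (η * Real.sqrt n) := by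
  refine Real.rpow_le_rpow_of_exponent_ge (by norm_num) (by norm_num) ?_
  rw [mul_div_assoc]
  refine mul_le_mul_of_nonneg_left (h.cast_div_ge.trans ?_) hη0
  gcongr

omit [NeZero n] in
theorem run_one (h : LargeEnough n r) (rule : ChoiceRule n) (ω : Coins n) :
    run (algAbr n r (1 / 4)) rule ω 1 =
      roundStep rule ⌊iterLog r n / iterLog (r + 1) n⌋₊ 1 (fun b j => ω (0, b, j))
        (run (algAbr n r (1 / 4)) rule ω 0) := by
  rw [run_succ, h.growing.req_zero]
  rfl

theorem prob_not_fewRequests_one_le (h : LargeEnough n r) (rule : ChoiceRule n) {η : ℝ}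
    (hη0 : 0 < η) (hx : 12 * Real.exp 1 ≤ η * iterLog (r - 1) n ^ (1 / 4 : ℝ)) :
    (coinMeasure n).real {ω | ¬ FewRequests (algAbr n r (1 / 4)) rule (kSeq n r (1 / 4)) η 1 ω} ≤
      2 * (1 / 2 : ℝ) ^ (η / 6 * Real.sqrt n) := by
  have hk1 := h.growing.pos 1
  -- The initial configuration does not depend on the coins, so a dummy outcome stands for it. The
  -- threshold `θ` is `6 w`, which exceeds `2 e w`.
  have h1 := prob_first_card_active_gt_le rule h.one_le_cap
    (run (algAbr n r (1 / 4)) rule (fun _ => 0) 0) (w := η * n / (6 * kSeq n r (1 / 4) 1))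
    (θ := η * n / kSeq n r (1 / 4) 1) (by positivity) (by positivity)
    (h.first_round_condition hx) (by
      have he := Real.exp_one_lt_d9
      have hq : 0 ≤ η * n / kSeq n r (1 / 4) 1 := by positivity
      have : η * n / (6 * kSeq n r (1 / 4) 1) = η * n / kSeq n r (1 / 4) 1 / 6 := by
        rw [div_div, mul_comm 6]
      rw [this]
      nlinarith)
  have h2 : (1 / 2 : ℝ) ^ (η * n / (6 * kSeq n r (1 / 4) 1)) ≤
      (1 / 2 : ℝ) ^ (η / 6 * Real.sqrt n) := by
    have := h.half_rpow_le (η := η / 6) (by positivity) hk1 (h.kSeq_le_sqrt 1)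
    convert this using 2
    field_simp
  have h3 : (1 / 2 : ℝ) ^ (η * n / kSeq n r (1 / 4) 1) ≤
      (1 / 2 : ℝ) ^ (η / 6 * Real.sqrt n) := by
    refine (h.half_rpow_le hη0.le hk1 (h.kSeq_le_sqrt 1)).trans
      (Real.rpow_le_rpow_of_exponent_ge (by norm_num) (by norm_num) ?_)
    gcongr
    linarith
  refine (measureReal_mono fun ω hω => ?_).trans (h1.trans ((add_le_add h2 h3).trans_eq
    (two_mul _).symm))
  have hr1 := h.run_one rule ω
  by_contra hcon
  refine hω fun j hj1 hj2 => ?_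
  obtain rfl : j = 1 := by omega
  rw [hr1, ← le_div_iff₀ hk1]
  exact not_lt.1 hcon

/-- The starting value of the geometric decay: since `k 1 ≤ n`, the exceptional event contributes at
most 1/4, and landing in a heavy bin contributes `η / 6`. -/
theorem mul_prob_mem_active_one_le (h : LargeEnough n r) (rule : ChoiceRule n) {η : ℝ}
    (hη0 : 0 < η) (hη : η ≤ 1 / 8)
    (hx : 12 * Real.exp 1 ≤ η * iterLog (r - 1) n ^ (1 / 4 : ℝ))
    (hn : (1 / 2 : ℝ) ^ (η / 6 * Real.sqrt n) ≤ (n : ℝ) ^ (-1 : ℝ) / 4) (b : Fin n) :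
    kSeq n r (1 / 4) 1 * (coinMeasure n).real
      {ω | b ∈ activeBalls (run (algAbr n r (1 / 4)) rule ω 1)} ≤ 1 := by
  have hk1 := h.growing.pos 1
  have hn0 := h.cast_ge
  have h1 := prob_first_mem_active_le rule h.one_le_cap
    (run (algAbr n r (1 / 4)) rule (fun _ => 0) 0) (w := η * n / (6 * kSeq n r (1 / 4) 1))
    (by positivity) (h.first_round_condition hx) b
  have h2 : (1 / 2 : ℝ) ^ (η * n / (6 * kSeq n r (1 / 4) 1)) ≤
      (1 / 2 : ℝ) ^ (η / 6 * Real.sqrt n) := by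
    have := h.half_rpow_le (η := η / 6) (by positivity) hk1 (h.kSeq_le_sqrt 1)
    convert this using 2
    field_simp
  have h3 : (coinMeasure n).real {ω | b ∈ activeBalls (run (algAbr n r (1 / 4)) rule ω 1)} ≤
      (n : ℝ) ^ (-1 : ℝ) / 4 + η * n / (6 * kSeq n r (1 / 4) 1) / n := by
    refine le_trans (le_of_eq ?_) (h1.trans (add_le_add (h2.trans hn) le_rfl))
    congr 1
    ext ω
    exact iff_of_eq (congrArg (fun s => b ∈ activeBalls s) (h.run_one rule ω))
  have h4 : kSeq n r (1 / 4) 1 ≤ n := by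
    have := h.kSeq_le_sqrt 1
    nlinarith [h.four_le_sqrt, h.sqrt_sq, h.logb_le]
  rw [Real.rpow_neg_one] at h3
  calc _ ≤ kSeq n r (1 / 4) 1 * ((n : ℝ)⁻¹ / 4 + η * n / (6 * kSeq n r (1 / 4) 1) / n) := by
        gcongr
    _ = kSeq n r (1 / 4) 1 / n / 4 + η / 6 := by
        field_simp
    _ ≤ 1 / 4 + η / 6 := by
        gcongr
        rw [div_le_one (by linarith)]
        exact h4
    _ ≤ 1 := by linarith

theorem prob_not_fewRequests_le' (h : LargeEnough n r) (hr : 1 ≤ r) (rule : ChoiceRule n)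
    {η : ℝ} (hη0 : 0 < η) (hη : η ≤ 1 / 8)
    (hx : 12 * Real.exp 1 ≤ η * iterLog (r - 1) n ^ (1 / 4 : ℝ)) :
    (coinMeasure n).real {ω | ¬ FewRequests (algAbr n r (1 / 4)) rule (kSeq n r (1 / 4)) η r ω} ≤
      (r + 1) * (1 / 2 : ℝ) ^ (η / 6 * Real.sqrt n) := by
  have h1 := prob_not_fewRequests_le h.growing rule hη0.le hη h.kSeq_le_sqrt
    (h.prob_not_fewRequests_one_le rule hη0 hx) (r - 1)
  have h3 : (1 / 2 : ℝ) ^ (η * n / Real.sqrt (Real.logb 2 n)) ≤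
      (1 / 2 : ℝ) ^ (η / 6 * Real.sqrt n) := by
    refine (h.half_rpow_le hη0.le (by linarith [h.four_le_sqrt]) le_rfl).trans
      (Real.rpow_le_rpow_of_exponent_ge (by norm_num) (by norm_num) ?_)
    gcongr
    linarith
  obtain ⟨i, rfl⟩ : ∃ i, r = i + 1 := ⟨r - 1, by omega⟩
  rw [Nat.add_sub_cancel] at h1
  refine h1.trans ?_
  push_cast
  nlinarith

end LargeEnough

theorem sq_le_two_pow {m : ℕ} (hm : 4 ≤ m) : m ^ 2 ≤ 2 ^ m := by
  induction m, hm using Nat.le_induction with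
  | base => norm_num
  | succ m hm ih => rw [pow_succ 2]; nlinarith

namespace LargeEnough

variable {n r : ℕ}

theorem req_eq (h : LargeEnough n r) (hr : 1 ≤ r) :
    (algAbr n r (1 / 4)).req r = ⌊Real.sqrt (Real.logb 2 n)⌋₊ := by
  rw [h.growing.req, h.kSeq_eq_sqrt hr le_rfl]

theorem four_le_floor (h : LargeEnough n r) : 4 ≤ ⌊Real.sqrt (Real.logb 2 n)⌋₊ :=
  Nat.le_floor (by exact_mod_cast h.four_le_sqrt)

/-- The survival probability of a ball in the last phase. -/
theorem survival_le (h : LargeEnough n r) :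
    (((n : ℝ) * (1 / 2) ^ ⌊Real.sqrt (Real.logb 2 n)⌋₊) * ⌊Real.sqrt (Real.logb 2 n)⌋₊ / n) ^
      ⌊Real.sqrt (Real.logb 2 n)⌋₊ ≤ (n : ℝ) ^ (-(1 / 4) : ℝ) := by
  set M := ⌊Real.sqrt (Real.logb 2 n)⌋₊ with hM
  have hn : (0 : ℝ) < n := by linarith [h.cast_ge]
  have h1 : (n : ℝ) * (1 / 2) ^ M * M / n = (1 / 2) ^ M * M := by field_simp
  have h2 : ((M : ℝ)) ^ 2 ≤ (2 : ℝ) ^ M := by exact_mod_cast sq_le_two_pow h.four_le_floor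
  -- As `M ^ 2 ≤ 2 ^ M`, the base is at most `2 ^ (-M / 2)`, so its `M`-th power is at most `2 ^ (-M
  -- ^ 2 / 2)`. Since `2 M ^ 2 ≥ log n` despite the floor, the exponent `-1/4` results. Squares are
  -- compared to avoid half-integer powers.
  have h3 : ((1 / 2 : ℝ) ^ M * M) ^ 2 ≤ (2 : ℝ) ^ (-(M : ℝ)) := by
    rw [mul_pow, Real.rpow_neg two_pos.le, Real.rpow_natCast, ← inv_pow]
    calc ((1 / 2 : ℝ) ^ M) ^ 2 * (M : ℝ) ^ 2 ≤ ((1 / 2 : ℝ) ^ M) ^ 2 * 2 ^ M := by gcongr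
      _ = (1 / 2 : ℝ) ^ M * ((1 / 2) ^ M * 2 ^ M) := by ring
      _ = (2 : ℝ)⁻¹ ^ M := by rw [← mul_pow]; norm_num
  rw [h1]
  have hM2 : Real.logb 2 n ≤ 2 * (M : ℝ) ^ 2 := by
    have h4 := Nat.lt_floor_add_one (Real.sqrt (Real.logb 2 n))
    rw [← hM] at h4
    have h5 := h.four_le_sqrt
    have h6 := h.sqrt_sq
    have h7 : (4 : ℝ) ≤ M := by exact_mod_cast h.four_le_floor
    nlinarith
  refine (pow_le_pow_iff_left₀ (by positivity) (by positivity) two_ne_zero).1 ?_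
  calc (((1 / 2 : ℝ) ^ M * M) ^ M) ^ 2 = (((1 / 2 : ℝ) ^ M * M) ^ 2) ^ M := by
        rw [← pow_mul, ← pow_mul, mul_comm M 2]
    _ ≤ ((2 : ℝ) ^ (-(M : ℝ))) ^ M := by gcongr
    _ = (2 : ℝ) ^ (-(M : ℝ) * M) := by rw [← Real.rpow_natCast, ← Real.rpow_mul two_pos.le]
    _ ≤ (2 : ℝ) ^ (Real.logb 2 n * -(1 / 2)) := by
      refine Real.rpow_le_rpow_of_exponent_le one_le_two ?_
      nlinarith
    _ = ((n : ℝ) ^ (-(1 / 4) : ℝ)) ^ 2 := by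
      rw [Real.rpow_mul two_pos.le, h.two_rpow_logb, ← Real.rpow_natCast,
        ← Real.rpow_mul hn.le]
      norm_num

/-- `2 ^ M ≤ √n`, because `√(log n) ≤ (log n) / 2`. Hence the threshold `n 2 ^ (-M)` is large enough
for a concentration error of at most `2 ^ (-√n)`. -/
theorem sqrt_le_mul_half_pow (h : LargeEnough n r) :
    Real.sqrt n ≤ n * (1 / 2 : ℝ) ^ ⌊Real.sqrt (Real.logb 2 n)⌋₊ := by
  set M := ⌊Real.sqrt (Real.logb 2 n)⌋₊ with hM
  have hn : (0 : ℝ) < n := by linarith [h.cast_ge]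
  have h5 := h.four_le_sqrt
  have h6 := h.sqrt_sq
  have h4 : (M : ℝ) ≤ Real.sqrt (Real.logb 2 n) := Nat.floor_le (by linarith)
  have h1 : (2 : ℝ) ^ M ≤ Real.sqrt n := by
    rw [← Real.rpow_natCast, Real.sqrt_eq_rpow]
    calc (2 : ℝ) ^ (M : ℝ) ≤ (2 : ℝ) ^ (Real.logb 2 n * (1 / 2)) :=
          Real.rpow_le_rpow_of_exponent_le one_le_two (by nlinarith)
      _ = (n : ℝ) ^ (1 / 2 : ℝ) := by rw [Real.rpow_mul two_pos.le, h.two_rpow_logb]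
  have h2 : (2 : ℝ) ^ M * (1 / 2) ^ M = 1 := by rw [← mul_pow]; norm_num
  have h3 : Real.sqrt n * Real.sqrt n = n := Real.mul_self_sqrt hn.le
  calc Real.sqrt n = Real.sqrt n * ((2 : ℝ) ^ M * (1 / 2) ^ M) := by rw [h2, mul_one]
    _ ≤ Real.sqrt n * (Real.sqrt n * (1 / 2) ^ M) := by gcongr
    _ = n * (1 / 2 : ℝ) ^ M := by rw [← mul_assoc, h3]

/-- The choice `1 + y = log n = 2 ^ (log log n)` turns the exponent `a log n / log log n` into the
power `n ^ (-a)`. The prefactor costs at most `n ^ 3`, since `2 ≤ 3 log 2`. -/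
theorem bin_tail_le (h : LargeEnough n r) (a : ℝ) :
    Real.exp (2 * (Real.logb 2 n - 1)) *
      (1 + (Real.logb 2 n - 1)) ^ (-(a * (Real.logb 2 n / Real.logb 2 (Real.logb 2 n)))) ≤
      (n : ℝ) ^ (3 - a) := by
  have hn : (0 : ℝ) < n := by linarith [h.cast_ge]
  have hL := h.logb_ge
  have hl2 := Real.log_two_gt_d9
  have hLL : 0 < Real.logb 2 (Real.logb 2 n) := Real.logb_pos one_lt_two (by linarith)
  have h1 : (1 + (Real.logb 2 n - 1)) ^ (-(a * (Real.logb 2 n / Real.logb 2 (Real.logb 2 n)))) =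
      (n : ℝ) ^ (-a) := by
    rw [add_sub_cancel]
    nth_rewrite 1 [← Real.rpow_logb two_pos (by norm_num) (show 0 < Real.logb 2 n by linarith)]
    rw [← Real.rpow_mul two_pos.le]
    have : Real.logb 2 (Real.logb 2 n) *
        -(a * (Real.logb 2 n / Real.logb 2 (Real.logb 2 n))) = Real.logb 2 n * -a := by
      field_simp
    rw [this, Real.rpow_mul two_pos.le, h.two_rpow_logb]
  have h2 : Real.exp (2 * (Real.logb 2 n - 1)) ≤ (n : ℝ) ^ (3 : ℝ) := by
    rw [Real.rpow_def_of_pos hn, Real.exp_le_exp]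
    have h3 : Real.log n = Real.logb 2 n * Real.log 2 := by
      rw [Real.logb, div_mul_cancel₀ _ (by linarith)]
    rw [h3]
    nlinarith
  rw [h1, show 3 - a = 3 + -a by ring, Real.rpow_add hn]
  gcongr

end LargeEnough

theorem rpow_neg_add_le {n : ℕ} (hn : (16 : ℝ) ≤ n) {c e : ℝ} (h : e ≤ -c - 1) :
    (n : ℝ) ^ e ≤ (n : ℝ) ^ (-c) / 4 := by
  have hn0 : (0 : ℝ) < n := by linarith
  calc (n : ℝ) ^ e ≤ (n : ℝ) ^ (-c - 1) := Real.rpow_le_rpow_of_exponent_le (by linarith) h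
    _ = (n : ℝ) ^ (-c) / n := by rw [Real.rpow_sub hn0, Real.rpow_one]
    _ ≤ (n : ℝ) ^ (-c) / 4 := by gcongr; linarith

theorem prob_bad_algAbr_le {n r : ℕ} [NeZero n] (h : LargeEnough n r) (hr : 1 ≤ r)
    (rule : ChoiceRule n) {c η : ℝ} {j : ℕ} (hj : 4 * (c + 2) ≤ j) (hη0 : 0 < η)
    (hη : η ≤ 1 / 8) (hηj : η * (r + j : ℕ) ≤ 1)
    (hx : 12 * Real.exp 1 ≤ η * iterLog (r - 1) n ^ (1 / 4 : ℝ))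
    (hq : (r + 1) * (1 / 2 : ℝ) ^ (η / 6 * Real.sqrt n) ≤ (n : ℝ) ^ (-c) / 4)
    (hq' : (1 : ℝ) * (1 / 2 : ℝ) ^ (1 * Real.sqrt n) ≤ (n : ℝ) ^ (-c) / 4) :
    (coinMeasure n).real {ω |
      ¬ (FewRequests (algAbr n r (1 / 4)) rule (kSeq n r (1 / 4)) η r ω ∧
        TerminatedBy (algAbr n r (1 / 4)) rule ω (r + 1 + j) ∧
        ∀ v, (binRequests (algAbr n r (1 / 4)) rule ω (r + 1 + j) v : ℝ) ≤
          (c + 5) * (Real.logb 2 n / Real.logb 2 (Real.logb 2 n)))} ≤ (n : ℝ) ^ (-c) := by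
  have hn : (0 : ℝ) < n := by linarith [h.cast_ge]
  set M := ⌊Real.sqrt (Real.logb 2 n)⌋₊ with hM
  have hS := h.four_le_sqrt
  have hbad := prob_bad_le h.growing rule hr (h.kSeq_const hr) j hηj
    (θ := n * (1 / 2) ^ M) (by positivity) (by
      rw [h.req_eq hr, h.kSeq_eq_sqrt hr le_rfl, ← hM]
      have he := Real.exp_one_lt_d9
      have h1 : η ^ M ≤ (1 / 2 : ℝ) ^ M := by gcongr; linarith
      have h2 : η * n / Real.sqrt (Real.logb 2 n) ≤ 1 / 8 * n :=
        (div_le_self (by positivity) (by linarith)).trans (by gcongr)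
      calc 2 * Real.exp 1 * (η * n / Real.sqrt (Real.logb 2 n)) * η ^ M
          ≤ 2 * Real.exp 1 * (1 / 8 * n) * (1 / 2) ^ M := by gcongr
        _ = Real.exp 1 / 4 * (n * (1 / 2) ^ M) := by ring
        _ ≤ 1 * (n * (1 / 2) ^ M) := by gcongr; linarith
        _ = n * (1 / 2) ^ M := one_mul _)
    (y := Real.logb 2 n - 1) (by linarith [h.logb_ge])
    ((c + 5) * (Real.logb 2 n / Real.logb 2 (Real.logb 2 n)))
  rw [h.req_eq hr, ← hM] at hbad
  have t1 := (h.prob_not_fewRequests_le' hr rule hη0 hη hx).trans hq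
  have t2 : (1 / 2 : ℝ) ^ (n * (1 / 2) ^ M : ℝ) ≤ (n : ℝ) ^ (-c) / 4 := by
    refine le_trans ?_ hq'
    rw [one_mul, one_mul]
    exact Real.rpow_le_rpow_of_exponent_ge (by norm_num) (by norm_num) h.sqrt_le_mul_half_pow
  -- `j ≥ 4 (c + 2)` is what gives `1 - j / 4 ≤ -c - 1`.
  have t3 : (n : ℝ) * (((n : ℝ) * (1 / 2) ^ M * M / n) ^ M) ^ j ≤ (n : ℝ) ^ (-c) / 4 := by
    calc _ ≤ (n : ℝ) * ((n : ℝ) ^ (-(1 / 4) : ℝ)) ^ j := by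
          gcongr; exact h.survival_le
      _ = (n : ℝ) ^ (1 + -(1 / 4) * j : ℝ) := by
          rw [Real.rpow_add hn, Real.rpow_one, Real.rpow_mul hn.le, Real.rpow_natCast]
      _ ≤ _ := rpow_neg_add_le h.cast_ge (by linarith)
  -- The constant `c + 5` is the sum of 1 for the union over bins, 3 from the prefactor, and `c + 1`
  -- for the target.
  have t4 : (n : ℝ) * (Real.exp (2 * (Real.logb 2 n - 1)) * (1 + (Real.logb 2 n - 1)) ^
      (-((c + 5) * (Real.logb 2 n / Real.logb 2 (Real.logb 2 n))))) ≤ (n : ℝ) ^ (-c) / 4 := by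
    calc _ ≤ (n : ℝ) * (n : ℝ) ^ (3 - (c + 5)) := by
          gcongr; exact h.bin_tail_le (c + 5)
      _ = (n : ℝ) ^ (1 + (3 - (c + 5))) := by rw [Real.rpow_add hn, Real.rpow_one]
      _ ≤ _ := rpow_neg_add_le h.cast_ge (by linarith)
  linarith

theorem eventually_le_mul_iterLog_rpow (r : ℕ) (K : ℝ) {η : ℝ} (hη0 : 0 < η) :
    ∀ᶠ n : ℕ in atTop, K ≤ η * iterLog (r - 1) n ^ (1 / 4 : ℝ) := by
  have h1 := ((tendsto_rpow_atTop (y := 1 / 4) (by norm_num)).comp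
    (tendsto_iterLog (r - 1))).const_mul_atTop hη0
  exact h1.eventually_ge_atTop K

theorem sum_cap_algAbr (n r : ℕ) (γ : ℝ) (T : ℕ) :
    ∑ t ∈ Finset.range (T + 1), (algAbr n r γ).cap t =
      T + ⌊iterLog r n / iterLog (r + 1) n⌋₊ := by
  rw [Finset.sum_range_succ']
  simp [algAbr]

/-- High probability bounds. -/
theorem algAbr_whp {c : ℝ} (hc : 0 < c) : ∃ C : ℕ, ∀ r : ℕ, 1 ≤ r → ∃ n₀ : ℕ, ∀ n : ℕ, n₀ ≤ n →
    ∀ [NeZero n] (rule : ChoiceRule n),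
      1 - 1 / (n : ℝ) ^ c ≤ (coinMeasure n).real {ω : Coins n |
        TerminatedBy (algAbr n r (1 / 4)) rule ω (r + C) ∧
        (∀ t v, (load (algAbr n r (1 / 4)) rule ω t v : ℝ) ≤
          iterLog r n / iterLog (r + 1) n + r + C) ∧
        (∀ t, totalRequests (algAbr n r (1 / 4)) rule ω t ≤ n) ∧
        (∀ t, totalMessages (algAbr n r (1 / 4)) rule ω t ≤ C * n) ∧
        (∀ t b, (ballMessages (algAbr n r (1 / 4)) rule ω t b : ℝ) ≤
          C * Real.sqrt (Real.logb 2 n)) ∧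
        (∀ t v, (binMessages (algAbr n r (1 / 4)) rule ω t v : ℝ) ≤
          C * (Real.logb 2 n / Real.logb 2 (Real.logb 2 n)))} := by
  obtain ⟨j, hj⟩ := exists_nat_ge (4 * (c + 2))
  -- The ball messages determine this constant: `2 ((j + 2) + 1) √(log n) + 1 ≤ (2 j + 7) √(log n)`.
  -- It also covers the `j + 1` extra rounds, the `5 n` messages in total, and the factor `3 (c +
  -- 5)` for the bins.
  refine ⟨2 * j + 7, fun r hr => ?_⟩
  have hrj : (0 : ℝ) < 8 * (r + j : ℕ) := by
    have : 0 < r + j := by omega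
    positivity
  -- Letting `η` shrink with `r` keeps the requests of all rounds after the first below `n` in
  -- total. This affects only how large `n` has to be, not `C`.
  set η : ℝ := 1 / (8 * (r + j : ℕ)) with hη
  have hη0 : 0 < η := by positivity
  have hηj : η * (r + j : ℕ) ≤ 1 := by
    rw [hη, div_mul_eq_mul_div, one_mul, div_le_one hrj]
    linarith
  have hη8 : η ≤ 1 / 8 := by
    rw [hη]
    refine one_div_le_one_div_of_le (by norm_num) ?_
    have : (1 : ℝ) ≤ (r + j : ℕ) := by exact_mod_cast (show 1 ≤ r + j by omega)
    linarith
  have hloglog := (tendsto_iterLog 1).eventually (eventually_mul_one_add_logb_le (r + 1 + j))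
  obtain ⟨n₀, hn₀⟩ := eventually_atTop.1 ((eventually_largeEnough hr).and
    ((eventually_le_mul_iterLog_rpow r (12 * Real.exp 1) hη0).and
    ((eventually_mul_half_rpow_sqrt_le (r + 1) c (show 0 < η / 6 by positivity)).and
    ((eventually_mul_half_rpow_sqrt_le 1 c one_pos).and hloglog))))
  refine ⟨n₀, fun n hn _ rule => ?_⟩
  obtain ⟨h, hx, hq, hq', hll⟩ := hn₀ n hn
  have hbad := prob_bad_algAbr_le h hr rule hj hη0 hη8 hηj hx hq hq'
  have hn0 : (0 : ℝ) < n := by linarith [h.cast_ge]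
  rw [Real.rpow_neg hn0.le, ← one_div] at hbad
  refine le_trans ?_ ((sub_le_sub_left hbad 1).trans ?_)
  · exact le_rfl
  rw [sub_le_iff_le_add]
  -- Subadditivity over the good and the bad event suffices, so the good event need not be shown
  -- measurable.
  refine (probReal_univ (μ := coinMeasure n)).symm.le.trans
    ((measureReal_mono fun ω _ => ?_).trans (measureReal_union_le _ _))
  by_cases hω : FewRequests (algAbr n r (1 / 4)) rule (kSeq n r (1 / 4)) η r ω ∧
        TerminatedBy (algAbr n r (1 / 4)) rule ω (r + 1 + j) ∧
        ∀ v, (binRequests (algAbr n r (1 / 4)) rule ω (r + 1 + j) v : ℝ) ≤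
          (c + 5) * (Real.logb 2 n / Real.logb 2 (Real.logb 2 n))
  swap
  · exact Or.inr hω
  left
  obtain ⟨hF, hT, hB⟩ := hω
  have hF' := hF.of_eventually_const hr (fun t => (h.growing.pos t).le) (h.kSeq_const hr)
  have hS := h.four_le_sqrt
  refine ⟨hT.mono (by omega), fun t v => ?_,
    totalRequests_le_of_fewRequests h.growing (by linarith) hF', fun t => ?_, fun t b => ?_,
    fun t v => ?_⟩
  · have h1 := (load_le_of_terminatedBy hT t v).trans (load_le_sum_cap _ _ _ _ _)
    rw [show r + 1 + j = r + j + 1 by ring, sum_cap_algAbr] at h1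
    have h2 : (load (algAbr n r (1 / 4)) rule ω t v : ℝ) ≤
        ((r + j + ⌊iterLog r n / iterLog (r + 1) n⌋₊ : ℕ) : ℝ) := by exact_mod_cast h1
    have h3 := Nat.floor_le (a := iterLog r n / iterLog (r + 1) n) (by
      have := h.iterLog_ge r (by omega)
      have := h.iterLog_ge (r + 1) (by omega)
      positivity)
    push_cast at h2 ⊢
    have : (0 : ℝ) ≤ j := Nat.cast_nonneg j
    linarith
  · have h1 := sum_totalRequests_le h.growing hηj (hF' (r + j))
      (by rwa [show r + j + 1 = r + 1 + j by ring]) t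
    have h2 := totalMessages_le (algAbr n r (1 / 4)) rule ω t
    nlinarith
  · have h1 := ballMessages_le (algAbr n r (1 / 4)) rule ω t b
    have h2 := (ballRequests_le_of_terminatedBy hT t b).trans
      (ballRequests_le_sum_req (algAbr n r (1 / 4)) rule ω (r + 1 + j) b)
    have h3 := h.sum_req_le j
    have h4 : (ballMessages (algAbr n r (1 / 4)) rule ω t b : ℝ) ≤
        2 * ((∑ t ∈ Finset.range (r + 1 + j), (algAbr n r (1 / 4)).req t : ℕ) : ℝ) + 1 := by
      exact_mod_cast h1.trans (by omega)
    rw [← iterLog_succ] at hll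
    rw [iterLog_one] at hll
    push_cast
    linarith
  · have h1 := (binMessages_le (algAbr n r (1 / 4)) rule ω t v).trans
      (Nat.mul_le_mul_left 3 (binRequests_le_of_terminatedBy hT t v))
    have h2 : (binMessages (algAbr n r (1 / 4)) rule ω t v : ℝ) ≤
        3 * binRequests (algAbr n r (1 / 4)) rule ω (r + 1 + j) v := by exact_mod_cast h1
    have h3 := hB v
    have hLL : 0 < Real.logb 2 (Real.logb 2 n) :=
      Real.logb_pos one_lt_two (by linarith [h.logb_ge])
    have h4 : 0 ≤ Real.logb 2 n / Real.logb 2 (Real.logb 2 n) := by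
      have := h.logb_ge
      positivity
    have h5 : 3 * (c + 5) ≤ ((2 * j + 7 : ℕ) : ℝ) := by
      push_cast
      linarith
    calc _ ≤ 3 * ((c + 5) * (Real.logb 2 n / Real.logb 2 (Real.logb 2 n))) := by linarith
      _ = 3 * (c + 5) * (Real.logb 2 n / Real.logb 2 (Real.logb 2 n)) := by ring
      _ ≤ _ := by gcongr

/-- Expected numbers of messages. -/
theorem algAbr_expectation {r : ℕ} (hr : 1 ≤ r) : ∃ n₀ : ℕ, ∀ n : ℕ, n₀ ≤ n →
    ∀ [NeZero n] (rule : ChoiceRule n),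
      (∀ b, ∫⁻ ω, ⨆ t, (ballMessages (algAbr n r (1 / 4)) rule ω t b : ENNReal)
          ∂(coinMeasure n) ≤ 12) ∧
      (∀ v, ∫⁻ ω, ⨆ t, (binMessages (algAbr n r (1 / 4)) rule ω t v : ENNReal)
          ∂(coinMeasure n) ≤ 12) := by
  -- A fixed `η` suffices here, since expected requests decay geometrically. The exponent 3 in the
  -- error bound cancels the crude `n ^ 3` for the bins.
  have hη0 : (0 : ℝ) < 1 / 8 := by norm_num
  obtain ⟨n₀, hn₀⟩ := eventually_atTop.1 ((eventually_largeEnough hr).and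
    ((eventually_le_mul_iterLog_rpow r (12 * Real.exp 1) hη0).and
    (eventually_mul_half_rpow_sqrt_le (r + 1) 3 (show (0 : ℝ) < 1 / 8 / 6 by norm_num))))
  refine ⟨n₀, fun n hn _ rule => ?_⟩
  obtain ⟨h, hx, hq⟩ := hn₀ n hn
  have hn1 := h.cast_ge
  have hn0 : (0 : ℝ) < n := by linarith
  have hfew := (h.prob_not_fewRequests_le' hr rule hη0 le_rfl hx).trans hq
  have h3 : (n : ℝ) ^ 3 * (coinMeasure n).real
      {ω | ¬ FewRequests (algAbr n r (1 / 4)) rule (kSeq n r (1 / 4)) (1 / 8) r ω} ≤ 1 := by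
    calc _ ≤ (n : ℝ) ^ 3 * ((n : ℝ) ^ (-3 : ℝ) / 4) := by gcongr
      _ = 1 / 4 := by
        rw [Real.rpow_neg hn0.le]
        norm_num
        field_simp
      _ ≤ 1 := by norm_num
  have h2 : (n : ℝ) ^ 2 * (coinMeasure n).real
      {ω | ¬ FewRequests (algAbr n r (1 / 4)) rule (kSeq n r (1 / 4)) (1 / 8) r ω} ≤ 1 := by
    refine le_trans ?_ h3
    gcongr
    · linarith
    · norm_num
  have hfirst := fun b => h.mul_prob_mem_active_one_le rule hη0 le_rfl hx (by
    refine le_trans (le_mul_of_one_le_left (by positivity) ?_) (hq.trans ?_)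
    · have : (0 : ℝ) ≤ r := Nat.cast_nonneg r
      linarith
    · gcongr
      · linarith
      · norm_num) b
  refine ⟨fun b => ?_, fun v => ?_⟩
  · exact (lintegral_iSup_ballMessages_le h.growing rule hη0.le le_rfl hr (h.kSeq_const hr)
      h.req_le_cast h2 b (hfirst b)).trans (by norm_num)
  · exact lintegral_iSup_binMessages_le h.growing rule hη0.le le_rfl hr (h.kSeq_const hr)
      h.req_le_cast h3 v hfirst

end Main

theorem mainTheorem9 :
    ∃ γ : ℝ, 0 < γ ∧
      -- with high probability
      (∀ c : ℝ, 0 < c → ∃ C : ℕ, ∀ r : ℕ, 1 ≤ r → ∃ n₀ : ℕ, ∀ n : ℕ, n₀ ≤ n →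
        ∀ [NeZero n] (rule : ChoiceRule n),
          1 - 1 / (n : ℝ) ^ c ≤ (coinMeasure n).real {ω : Coins n |
            -- running time
            TerminatedBy (algAbr n r γ) rule ω (r + C) ∧
            -- maximum bin load
            (∀ t v, (load (algAbr n r γ) rule ω t v : ℝ) ≤
              iterLog r n / iterLog (r + 1) n + r + C) ∧
            -- requests per round, and messages in total
            (∀ t, totalRequests (algAbr n r γ) rule ω t ≤ n) ∧
            (∀ t, totalMessages (algAbr n r γ) rule ω t ≤ C * n) ∧
            -- messages per ball and per bin
            (∀ t b, (ballMessages (algAbr n r γ) rule ω t b : ℝ) ≤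
              C * Real.sqrt (Real.logb 2 n)) ∧
            (∀ t v, (binMessages (algAbr n r γ) rule ω t v : ℝ) ≤
              C * (Real.logb 2 n / Real.logb 2 (Real.logb 2 n)))}) ∧
      -- in expectation
      (∃ D : ℕ, ∀ r : ℕ, 1 ≤ r → ∃ n₀ : ℕ, ∀ n : ℕ, n₀ ≤ n →
        ∀ [NeZero n] (rule : ChoiceRule n),
          (∀ b, ∫⁻ ω, ⨆ t, (ballMessages (algAbr n r γ) rule ω t b : ENNReal)
              ∂(coinMeasure n) ≤ D) ∧
          (∀ v, ∫⁻ ω, ⨆ t, (binMessages (algAbr n r γ) rule ω t v : ENNReal)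
              ∂(coinMeasure n) ≤ D)) := by
  refine ⟨1 / 4, by norm_num, fun c hc => algAbr_whp hc, 12, fun r hr => ?_⟩
  exact_mod_cast algAbr_expectation hr
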